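/- **Lemma 2.4.** Let $\varepsilon_0>0$, $M>0$, $\varepsilon>0$ and $c>1$. Then there are constants $c_1>0$ and $K>0$, depending only on $\varepsilon_0,M,\varepsilon,c$, such that the following holds. Let $\xi_0,\xi_1,\xi_2,\dots$ be independent real random variables on a probability space with $\mathbf E\,\xi_j=0$, $\mathrm{Var}(\xi_j)=1$ and $\mathbf E|\xi_j|^{2+\varepsilon_0}\le M$ for all $j\ge 0$. Put $p_n(x)=\xi_0+\xi_1x+\dots+\xi_nx^n$ and let $N_n[0,1]$ be the number of roots of $p_n$ in $[0,1]$, counted with multiplicity. Then for every integer $n\ge 1$, $$\mathbf P\Big(\max_{n\le k\le cn}\big|N_k[0,1]-N_n[0,1]\big|\ \ge\ \varepsilon\log n\Big)\ \le\ K\,n^{-c_1},$$ where the maximum is over integers $k$. (If $p_k$ or $p_n$ vanishes identically, $|N_k[0,1]-N_n[0,1]|$ is read as $+\infty$.) -/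

import Mathlib

open MeasureTheory ProbabilityTheory Polynomial
open scoped ENNReal

noncomputable section

namespace KacRoots

/-- The random polynomial `ξ₀ + ξ₁ x + ⋯ + ξₙ xⁿ` at the sample point `ω`. -/
def kacPoly {Ω : Type*} (ξ : ℕ → Ω → ℝ) (n : ℕ) (ω : Ω) : ℝ[X] :=
  ∑ j ∈ Finset.range (n + 1), C (ξ j ω) * X ^ j

open Classical in
/-- The number of roots of the real polynomial `p` in `I`, counted with multiplicity.
Every point is a root of infinite multiplicity of the zero polynomial. -/
def rootCount (p : ℝ[X]) (I : Set ℝ) : ℕ∞ :=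
  if p = 0 then ⊤ * I.encard else ((p.roots.filter (fun x => x ∈ I)).card : ℕ∞)

/-- The absolute difference `|a - b|` of two root counts. It is the usual one when both are finite
and `∞` as soon as one of them is infinite (also when both are). -/
def absDiff (a b : ℕ∞) : ℝ≥0∞ :=
  if a = ⊤ ∨ b = ⊤ then ⊤ else ENNReal.ofReal |(a.toNat : ℝ) - (b.toNat : ℝ)|

/-- The maximum over the integers `k` with `n ≤ k ≤ c n` of `|N_k(I) - N_n(I)|`. -/
def maxDeviation {Ω : Type*} (ξ : ℕ → Ω → ℝ) (c : ℝ) (I : Set ℝ) (n : ℕ) (ω : Ω) : ℝ≥0∞ :=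
  ⨆ k ∈ Finset.Icc n ⌊c * (n : ℝ)⌋₊,
    absDiff (rootCount (kacPoly ξ k ω) I) (rootCount (kacPoly ξ n ω) I)

/-- The coefficients are independent random variables with mean `0`, variance `1`, and
`(2 + ε₀)`-th absolute moments at most `M`. -/
structure Admissible {Ω : Type*} [MeasurableSpace Ω] (μ : Measure Ω) (ξ : ℕ → Ω → ℝ)
    (ε₀ M : ℝ) : Prop where
  measurable : ∀ j, Measurable (ξ j)
  indep : iIndepFun ξ μ
  mean : ∀ j, ∫ ω, ξ j ω ∂μ = 0
  variance : ∀ j, ProbabilityTheory.variance (ξ j) μ = 1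
  integrable_moment : ∀ j, Integrable (fun ω => |ξ j ω| ^ (2 + ε₀)) μ
  moment_le : ∀ j, ∫ ω, |ξ j ω| ^ (2 + ε₀) ∂μ ≤ M

end KacRoots

end

/-!
The number of roots of `p_k` in `[0, 1]` is compared with that of `p_n` region by region. Write
`S_m = ξ₀ + ⋯ + ξ_m`. By Doob's inequality all `|S_m|`, `m ≤ c n`, are at most `n ^ (1/2 + o(1))`
outside an event of polynomially small probability, and summation by parts then bounds all the
`p_k` on discs close to `1` and shows that `p_k(u) - p_n(u)` is at most `2 max |S_m| u ^ n` for
`u ∈ [0, 1]`.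

The probabilistic input is a small-ball estimate, `exists_measureReal_abs_eval_le`: for `u` close
to `1` and `0 ≤ m ≤ n`, the event `|p_n(u)| ≤ (1 - u) ^ (-1/2) u ^ m` has probability
`O(u ^ (3 m / 5))`. The coefficients are cut into blocks of length a large multiple of
`1 / (1 - u)`. A single block is spread at scales that are small but constant, by Gaussian smoothing
and a bound for characteristic functions near `0`; that bound is where the `(2 + ε₀)`-th moment
enters. The blocks are combined by `IndepFun.measureReal_abs_add_sub_le_mul`, which loses little at
each step although only second moments are available.

The deterministic input is the Blaschke bound `abs_eval_le_mul_pow_card`: a polynomial bounded by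
`M` on a circle and having `N` roots well inside it is at most `M q ^ N` there, `q < 1`.

* On `[exp (-h₀), 1 - a log n / n]` the counts agree with high probability. Cut a window at distance
  `h` from `1` into about `exp (0.29 n h)` cells. Two roots in one cell would make some `p_k`, hence
  `p_n`, small at an end point of the cell, to within the square of the relative cell length. As the
  small-ball exponent `3/5` exceeds `1/2`, a union bound over the end points excludes this. With at
  most one root in a cell, the count there is read off from the signs of the values at its end
  points, which are the same for `p_k` and `p_n`.
* On `[1 - a log n / n, 1]` the small-ball estimate for `p_n` at the left end controls every `p_k`
  at that point, and the Blaschke bound on the disc of twice the radius allows only `O(a log n)`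
  roots. No union bound over `k` is needed.
* On `[0, exp (-h₀)]` the same argument, with the small-ball estimate at a scale that is a small
  power of `1 / n`, allows only a small multiple of `log n` roots.
-/

namespace KacRoots

/-! ### Characteristic functions of normalised variables with a `(2 + ε₀)`-th moment -/

lemma norm_exp_mul_I_sub_taylor_le (x : ℝ) :
    ‖Complex.exp (x * Complex.I) - (1 + x * Complex.I - (x : ℂ) ^ 2 / 2)‖
      ≤ 4 * (x ^ 2 * min 1 |x|) := by
  rcases le_or_gt |x| 1 with h | h
  · have hx : ‖(x : ℂ) * Complex.I‖ ≤ 1 := by simpa using h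
    have := Complex.exp_bound hx (n := 3) (by norm_num)
    have e : ∑ m ∈ Finset.range 3, ((x : ℂ) * Complex.I) ^ m / (m.factorial : ℂ)
        = 1 + x * Complex.I - (x : ℂ) ^ 2 / 2 := by
      simp [Finset.sum_range_succ, mul_pow, Nat.factorial]; ring
    rw [e] at this
    refine this.trans ?_
    rw [min_eq_right h]
    have h3 : ‖(x : ℂ) * Complex.I‖ ^ 3 = x ^ 2 * |x| := by
      simp only [norm_mul, Complex.norm_real, Complex.norm_I, mul_one, Real.norm_eq_abs]
      rw [← sq_abs x]; ring
    rw [h3]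
    have : 0 ≤ x ^ 2 * |x| := by positivity
    norm_num [Nat.factorial]
    nlinarith
  · rw [min_eq_left h.le]
    have h1 : ‖Complex.exp (x * Complex.I)‖ = 1 := Complex.norm_exp_ofReal_mul_I x
    have h2 : ‖(1 + x * Complex.I - (x : ℂ) ^ 2 / 2)‖ ≤ 1 + |x| + x ^ 2 / 2 := by
      refine (norm_sub_le _ _).trans ?_
      gcongr
      · refine (norm_add_le _ _).trans ?_
        simp
      · simp
    have := norm_sub_le (Complex.exp (x * Complex.I)) (1 + x * Complex.I - (x : ℂ) ^ 2 / 2)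
    have h4 : x ^ 2 = |x| ^ 2 := (sq_abs x).symm
    nlinarith

/-- Below a level depending only on `ε₀` and `M`, the characteristic function of a variable with
mean `0`, variance `1` and `(2 + ε₀)`-th moment at most `M` is dominated by a Gaussian one. The
second-order Taylor remainder is split at `|X| = Λ`: the part below is cubic in `t`, the part above
is controlled by the moment. -/
lemma exists_norm_charFun_le (ε₀ M : ℝ) (hε₀ : 0 < ε₀) :
    ∃ t₀ : ℝ, 0 < t₀ ∧ ∀ (Ω : Type*) [MeasurableSpace Ω] (μ : Measure Ω) [IsProbabilityMeasure μ]
      (X : Ω → ℝ), Measurable X → ∫ ω, X ω ∂μ = 0 → MemLp X 2 μ → ∫ ω, X ω ^ 2 ∂μ = 1 →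
      Integrable (fun ω => |X ω| ^ (2 + ε₀)) μ → ∫ ω, |X ω| ^ (2 + ε₀) ∂μ ≤ M →
      ∀ t : ℝ, |t| ≤ t₀ → ‖charFun (μ.map X) t‖ ≤ Real.exp (-(t ^ 2 / 4)) := by
  obtain ⟨Λ, hΛ1, hΛ⟩ : ∃ Λ : ℝ, 1 ≤ Λ ∧ M * Λ ^ (-ε₀) ≤ 1 / 32 := by
    have : Filter.Tendsto (fun x : ℝ => M * x ^ (-ε₀)) Filter.atTop (nhds (M * 0)) :=
      (tendsto_rpow_neg_atTop hε₀).const_mul M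
    rw [mul_zero] at this
    have h2 := this.eventually (eventually_le_nhds (show (0:ℝ) < 1/32 by norm_num))
    obtain ⟨Λ, h⟩ := (h2.and (Filter.eventually_ge_atTop 1)).exists
    exact ⟨Λ, h.2, h.1⟩
  have hΛ0 : 0 < Λ := by linarith
  refine ⟨1 / (32 * Λ), by positivity, ?_⟩
  intro Ω _ μ _ X hX hmean hL2 hvar hint hM t ht
  have ht1 : |t| * Λ ≤ 1 / 32 := by
    calc |t| * Λ ≤ 1 / (32 * Λ) * Λ := by gcongr
      _ = 1 / 32 := by field_simp
  have hXint : Integrable X μ := hL2.integrable (by norm_num)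
  have hX2int : Integrable (fun ω => X ω ^ 2) μ := hL2.integrable_sq
  rw [charFun_apply_real, integral_map hX.aemeasurable (by fun_prop)]
  -- the Taylor remainder
  set R : Ω → ℂ := fun ω => Complex.exp (t * X ω * Complex.I)
    - (1 + (t * X ω : ℝ) * Complex.I - ((t * X ω : ℝ) : ℂ) ^ 2 / 2) with hR
  have hpt : ∀ ω, ‖R ω‖ ≤ 4 * t ^ 2 * (1 / 32 * X ω ^ 2 + Λ ^ (-ε₀) * |X ω| ^ (2 + ε₀)) := by
    intro ω
    have h := norm_exp_mul_I_sub_taylor_le (t * X ω)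
    have h' : ‖R ω‖ ≤ 4 * ((t * X ω) ^ 2 * min 1 |t * X ω|) := by
      simpa [hR] using h
    refine h'.trans ?_
    have key : X ω ^ 2 * min 1 |t * X ω| ≤ 1 / 32 * X ω ^ 2 + Λ ^ (-ε₀) * |X ω| ^ (2 + ε₀) := by
      rcases le_or_gt |X ω| Λ with hc | hc
      · have : min 1 |t * X ω| ≤ 1 / 32 := by
          refine (min_le_right _ _).trans ?_
          rw [abs_mul]
          exact (mul_le_mul_of_nonneg_left hc (abs_nonneg t)).trans ht1
        have h0 : 0 ≤ Λ ^ (-ε₀) * |X ω| ^ (2 + ε₀) := by positivity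
        nlinarith [sq_nonneg (X ω)]
      · have h1 : X ω ^ 2 * min 1 |t * X ω| ≤ X ω ^ 2 :=
          mul_le_of_le_one_right (sq_nonneg _) (min_le_left _ _)
        have hpos : 0 < |X ω| := hΛ0.trans hc
        have h2 : X ω ^ 2 ≤ Λ ^ (-ε₀) * |X ω| ^ (2 + ε₀) := by
          rw [Real.rpow_add hpos, Real.rpow_neg hΛ0.le]
          have : Λ ^ ε₀ ≤ |X ω| ^ ε₀ := Real.rpow_le_rpow hΛ0.le hc.le hε₀.le
          have h3 : |X ω| ^ (2:ℝ) = X ω ^ 2 := by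
            rw [Real.rpow_two, sq_abs]
          rw [h3]
          have hp : 0 < Λ ^ ε₀ := Real.rpow_pos_of_pos hΛ0 _
          rw [inv_mul_eq_div, le_div_iff₀ hp]
          gcongr
        nlinarith [sq_nonneg (X ω)]
    calc 4 * ((t * X ω) ^ 2 * min 1 |t * X ω|) = 4 * t ^ 2 * (X ω ^ 2 * min 1 |t * X ω|) := by ring
      _ ≤ _ := by gcongr
  have hbint : Integrable (fun ω => 4 * t ^ 2 * (1 / 32 * X ω ^ 2 + Λ ^ (-ε₀) * |X ω| ^ (2 + ε₀))) μ :=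
    ((hX2int.const_mul _).add (hint.const_mul _)).const_mul _
  have hRint : Integrable R μ := by
    refine hbint.mono' ?_ (Filter.Eventually.of_forall hpt)
    refine Measurable.aestronglyMeasurable ?_
    rw [hR]; fun_prop
  have hRle : ‖∫ ω, R ω ∂μ‖ ≤ t ^ 2 / 4 := by
    refine (norm_integral_le_integral_norm _).trans ?_
    refine (integral_mono hRint.norm hbint hpt).trans ?_
    rw [integral_const_mul, integral_add (hX2int.const_mul _) (hint.const_mul _),
      integral_const_mul, integral_const_mul, hvar]
    have : Λ ^ (-ε₀) * ∫ ω, |X ω| ^ (2 + ε₀) ∂μ ≤ 1 / 32 := by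
      refine le_trans ?_ hΛ
      rw [mul_comm]
      gcongr
    nlinarith [sq_nonneg t]
  have hpoly : ∫ ω, (1 + ((t * X ω : ℝ) : ℂ) * Complex.I - ((t * X ω : ℝ) : ℂ) ^ 2 / 2) ∂μ
      = 1 - (t : ℂ) ^ 2 / 2 := by
    have e : (fun ω => (1 + ((t * X ω : ℝ) : ℂ) * Complex.I - ((t * X ω : ℝ) : ℂ) ^ 2 / 2))
        = fun ω => (1 + (t * Complex.I) * (X ω : ℂ) - ((t : ℂ) ^ 2 / 2) * ((X ω ^ 2 : ℝ) : ℂ)) := by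
      ext ω; push_cast; ring
    rw [e, integral_sub, integral_add, integral_const_mul, integral_const_mul,
      integral_complex_ofReal, integral_complex_ofReal, hmean, hvar]
    · simp
    · exact integrable_const _
    · exact hXint.ofReal.const_mul _
    · exact (integrable_const _).add (hXint.ofReal.const_mul _)
    · exact hX2int.ofReal.const_mul _
  have hpolyint : Integrable (fun ω => (1 + ((t * X ω : ℝ) : ℂ) * Complex.I
      - ((t * X ω : ℝ) : ℂ) ^ 2 / 2)) μ := by
    have e : (fun ω => (1 + ((t * X ω : ℝ) : ℂ) * Complex.I - ((t * X ω : ℝ) : ℂ) ^ 2 / 2))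
        = fun ω => (1 + (t * Complex.I) * (X ω : ℂ) - ((t : ℂ) ^ 2 / 2) * ((X ω ^ 2 : ℝ) : ℂ)) := by
      ext ω; push_cast; ring
    rw [e]
    exact ((integrable_const _).add (hXint.ofReal.const_mul _)).sub (hX2int.ofReal.const_mul _)
  have hsplit : ∫ ω, Complex.exp (t * X ω * Complex.I) ∂μ
      = (1 - (t : ℂ) ^ 2 / 2) + ∫ ω, R ω ∂μ := by
    rw [← hpoly, ← integral_add hpolyint hRint]
    congr 1; ext ω; simp [hR]
  rw [hsplit]
  have ht2 : t ^ 2 ≤ 1 := by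
    have : |t| ≤ 1 := by nlinarith [abs_nonneg t]
    rw [← sq_abs]; nlinarith [abs_nonneg t]
  have hn : ‖(1 - (t : ℂ) ^ 2 / 2)‖ = 1 - t ^ 2 / 2 := by
    have : (1 - (t : ℂ) ^ 2 / 2) = ((1 - t ^ 2 / 2 : ℝ) : ℂ) := by push_cast; ring
    rw [this, Complex.norm_real, Real.norm_eq_abs, abs_of_nonneg (by linarith)]
  refine (norm_add_le _ _).trans ?_
  rw [hn]
  have := Real.one_sub_le_exp_neg (t ^ 2 / 4)
  linarith

/-! ### Gaussian smoothing -/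

/-- `E exp (-s G²) ≤ 1 / √(2 s)` for a standard Gaussian `G`. -/
lemma integral_exp_neg_mul_sq_gaussianReal_le {s : ℝ} (hs : 0 < s) :
    ∫ x, Real.exp (-(s * x ^ 2)) ∂gaussianReal 0 1 ≤ 1 / √(2 * s) := by
  rw [integral_gaussianReal_eq_integral_smul (by norm_num)]
  have e : ∀ x : ℝ, gaussianPDFReal 0 1 x • Real.exp (-(s * x ^ 2))
      = (√(2 * Real.pi))⁻¹ * Real.exp (-(1 / 2 + s) * x ^ 2) := by
    intro x
    simp only [gaussianPDFReal, smul_eq_mul, NNReal.coe_one, mul_one, sub_zero]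
    rw [mul_assoc, ← Real.exp_add]
    congr 2; ring
  simp_rw [e]
  rw [integral_const_mul, integral_gaussian, ← Real.sqrt_inv, ← Real.sqrt_mul (by positivity),
    one_div (√(2 * s)), ← Real.sqrt_inv]
  apply Real.sqrt_le_sqrt
  have : 0 < Real.pi := Real.pi_pos
  rw [show (2 * Real.pi)⁻¹ * (Real.pi / (1 / 2 + s)) = (1 + 2 * s)⁻¹ by field_simp]
  apply inv_anti₀ <;> linarith

/-- **Esseen-type inequality.** Smoothing by a Gaussian of variance `δ²` bounds the concentration of
a law at scale `δ` by a Gaussian average of its characteristic function. -/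
lemma measureReal_abs_sub_le_le_integral_charFun (ν : Measure ℝ) [IsProbabilityMeasure ν]
    (a : ℝ) {δ : ℝ} (hδ : 0 < δ) :
    ν.real {y | |y - a| ≤ δ} ≤ 2 * ∫ s, ‖charFun ν (s / δ)‖ ∂gaussianReal 0 1 := by
  set g : ℝ → ℝ := fun y => Real.exp (-(((y - a) / δ) ^ 2 / 2)) with hg
  have hgle : ∀ y, g y ≤ 1 := fun y => by
    rw [hg]; simp only; rw [Real.exp_le_one_iff]; have := sq_nonneg ((y - a) / δ); linarith
  have hgint : Integrable g ν := by
    refine Integrable.of_bound (C := 1) (by rw [hg]; fun_prop) (Filter.Eventually.of_forall fun y => ?_)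
    rw [Real.norm_eq_abs, abs_of_nonneg (Real.exp_pos _).le]; exact hgle y
  -- on the event, the Gaussian kernel is at least `exp (-1/2) ≥ 1/2`
  have h1 : ν.real {y | |y - a| ≤ δ} ≤ 2 * ∫ y, g y ∂ν := by
    have hsub : {y | |y - a| ≤ δ} ⊆ {y | 1 / 2 ≤ g y} := by
      intro y hy
      simp only [Set.mem_ofPred_eq] at hy ⊢
      have : ((y - a) / δ) ^ 2 ≤ 1 := by
        rw [div_pow, div_le_one (by positivity), ← sq_abs]
        gcongr
      have h2 : -(1/2) ≤ -(((y - a) / δ) ^ 2 / 2) := by linarith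
      have h3 := Real.add_one_le_exp (-(((y - a) / δ) ^ 2 / 2))
      have : (1:ℝ) / 2 ≤ -(((y - a) / δ) ^ 2 / 2) + 1 := by linarith
      exact this.trans h3
    have := mul_meas_ge_le_integral_of_nonneg (μ := ν) (f := g)
      (Filter.Eventually.of_forall fun y => (Real.exp_pos _).le) hgint (1 / 2)
    have := measureReal_mono (μ := ν) hsub
    linarith
  refine h1.trans ?_
  gcongr
  -- Fourier inversion of the kernel and Fubini
  have h2 : ((∫ y, g y ∂ν : ℝ) : ℂ)
      = ∫ y, ∫ s, Complex.exp (s * ((y - a) / δ : ℝ) * Complex.I) ∂gaussianReal 0 1 ∂ν := by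
    rw [← integral_complex_ofReal]
    congr 1; ext y
    have := charFun_gaussianReal (μ := 0) (v := 1) ((y - a) / δ)
    rw [charFun_apply_real] at this
    have e : (fun s : ℝ => Complex.exp (s * ((y - a) / δ : ℝ) * Complex.I))
        = fun s : ℝ => Complex.exp (((y - a) / δ : ℝ) * s * Complex.I) := by
      ext s; congr 1; ring
    rw [e, this, hg]
    push_cast
    congr 1; simp
  have hF : Integrable (Function.uncurry fun (y s : ℝ) =>
      Complex.exp (s * ((y - a) / δ : ℝ) * Complex.I)) (ν.prod (gaussianReal 0 1)) := by
    refine Integrable.of_bound (C := 1) ?_ (Filter.Eventually.of_forall fun p => ?_)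
    · refine Measurable.aestronglyMeasurable ?_
      unfold Function.uncurry; fun_prop
    · unfold Function.uncurry
      simp only
      rw [← Complex.ofReal_mul, Complex.norm_exp_ofReal_mul_I]
  rw [integral_integral_swap hF] at h2
  have h3 : ∀ s : ℝ, ∫ y, Complex.exp (s * ((y - a) / δ : ℝ) * Complex.I) ∂ν
      = Complex.exp (-(s * (a / δ) : ℝ) * Complex.I) * charFun ν (s / δ) := by
    intro s
    rw [charFun_apply_real, ← integral_const_mul]
    congr 1; ext y
    rw [← Complex.exp_add]; congr 1; push_cast; ring
  have h0 : 0 ≤ ∫ y, g y ∂ν := integral_nonneg fun y => (Real.exp_pos _).le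
  calc ∫ y, g y ∂ν = ‖((∫ y, g y ∂ν : ℝ) : ℂ)‖ := by
        rw [Complex.norm_real, Real.norm_eq_abs, abs_of_nonneg h0]
    _ ≤ ∫ s, ‖∫ y, Complex.exp (s * ((y - a) / δ : ℝ) * Complex.I) ∂ν‖ ∂gaussianReal 0 1 := by
        rw [h2]; exact norm_integral_le_integral_norm _
    _ = ∫ s, ‖charFun ν (s / δ)‖ ∂gaussianReal 0 1 := by
        congr 1; ext s
        rw [h3, norm_mul]
        have : ‖Complex.exp (-(s * (a / δ) : ℝ) * Complex.I)‖ = 1 := by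
          rw [← Complex.ofReal_neg, Complex.norm_exp_ofReal_mul_I]
        rw [this, one_mul]

/-- Concentration bound for a law whose characteristic function is dominated by the Gaussian one
of variance `V / 2` on `[-t₀, t₀]`. -/
lemma measureReal_abs_sub_le_of_charFun_le (ν : Measure ℝ) [IsProbabilityMeasure ν] {t₀ V : ℝ}
    (ht₀ : 0 < t₀) (hV : 0 < V)
    (h : ∀ t, |t| ≤ t₀ → ‖charFun ν t‖ ≤ Real.exp (-(V * t ^ 2 / 4)))
    (a : ℝ) {δ : ℝ} (hδ : 0 < δ) :
    ν.real {y | |y - a| ≤ δ} ≤ 4 * (δ / √V) + 2 / (t₀ * δ) ^ 2 := by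
  refine (measureReal_abs_sub_le_le_integral_charFun ν a hδ).trans ?_
  have hpt : ∀ s : ℝ, ‖charFun ν (s / δ)‖
      ≤ Real.exp (-(V / (4 * δ ^ 2) * s ^ 2)) + s ^ 2 / (t₀ * δ) ^ 2 := by
    intro s
    rcases le_or_gt |s / δ| t₀ with hs | hs
    · refine (h _ hs).trans ?_
      have e : -(V * (s / δ) ^ 2 / 4) = -(V / (4 * δ ^ 2) * s ^ 2) := by field_simp
      rw [e]
      have : 0 ≤ s ^ 2 / (t₀ * δ) ^ 2 := by positivity
      linarith
    · refine (norm_charFun_le_one _).trans ?_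
      have : 1 ≤ s ^ 2 / (t₀ * δ) ^ 2 := by
        rw [one_le_div (by positivity), ← sq_abs s]
        rw [abs_div, abs_of_pos hδ, lt_div_iff₀ hδ] at hs
        gcongr
      have h2 := Real.exp_pos (-(V / (4 * δ ^ 2) * s ^ 2))
      linarith
  have hi1 : Integrable (fun s : ℝ => Real.exp (-(V / (4 * δ ^ 2) * s ^ 2))) (gaussianReal 0 1) := by
    refine Integrable.of_bound (C := 1) (by fun_prop) (Filter.Eventually.of_forall fun y => ?_)
    rw [Real.norm_eq_abs, abs_of_nonneg (Real.exp_pos _).le, Real.exp_le_one_iff]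
    have : 0 ≤ V / (4 * δ ^ 2) * y ^ 2 := by positivity
    linarith
  have hmem : MemLp (fun s : ℝ => s) 2 (gaussianReal 0 1) := memLp_id_gaussianReal 2
  have hi2 : Integrable (fun s : ℝ => s ^ 2) (gaussianReal 0 1) := hmem.integrable_sq
  have hsq : ∫ s : ℝ, s ^ 2 ∂gaussianReal 0 1 = 1 := by
    have h1 := variance_id_gaussianReal (μ := 0) (v := 1)
    rw [variance_eq_sub (memLp_id_gaussianReal 2)] at h1
    simpa using h1
  have hm := integral_mono (μ := gaussianReal 0 1) ?_
    (hi1.add (hi2.div_const ((t₀ * δ) ^ 2))) hpt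
  · have h4 : ∫ s, (Real.exp (-(V / (4 * δ ^ 2) * s ^ 2)) + s ^ 2 / (t₀ * δ) ^ 2) ∂gaussianReal 0 1
        ≤ 2 * (δ / √V) + 1 / (t₀ * δ) ^ 2 := by
      rw [integral_add hi1 (hi2.div_const _), integral_div, hsq]
      gcongr
      refine (integral_exp_neg_mul_sq_gaussianReal_le (by positivity)).trans ?_
      have e : 2 * (V / (4 * δ ^ 2)) = V / 2 / δ ^ 2 := by field_simp; norm_num
      rw [e, Real.sqrt_div (by positivity), Real.sqrt_sq hδ.le, one_div_div]
      have h5 : √V ≤ 2 * √(V / 2) := by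
        rw [show (2:ℝ) = √4 by rw [show (4:ℝ) = 2 ^ 2 by norm_num]; simp,
          ← Real.sqrt_mul (by norm_num)]
        apply Real.sqrt_le_sqrt
        rw [show √4 = (2:ℝ) by rw [show (4:ℝ) = 2 ^ 2 by norm_num]; simp]
        linarith
      have h6 : 0 < √(V / 2) := Real.sqrt_pos.2 (by positivity)
      have h7 : 0 < √V := Real.sqrt_pos.2 hV
      rw [mul_div_assoc', div_le_div_iff₀ h6 h7]
      nlinarith
    have h8 := hm.trans h4
    have e2 : 4 * (δ / √V) + 2 / (t₀ * δ) ^ 2 = 2 * (2 * (δ / √V) + 1 / (t₀ * δ) ^ 2) := by ring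
    rw [e2]
    gcongr
  · refine Integrable.of_bound (C := 1) ?_ (Filter.Eventually.of_forall fun y => ?_)
    · exact ((measurable_charFun.comp (measurable_id.div_const δ)).norm).aestronglyMeasurable
    · rw [norm_norm]; exact norm_charFun_le_one _

/-! ### A maximal inequality for partial sums -/

/-- Weak-type maximal inequality for the partial sums of independent centred variables of variance
one, from Doob's inequality for the submartingale `|S_m|`. -/
lemma measureReal_exists_le_abs_sum_le {Ω : Type*} [MeasurableSpace Ω] {μ : Measure Ω}
    [IsProbabilityMeasure μ] {ξ : ℕ → Ω → ℝ} (hm : ∀ j, Measurable (ξ j)) (hind : iIndepFun ξ μ)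
    (hL2 : ∀ j, MemLp (ξ j) 2 μ) (hmean : ∀ j, ∫ ω, ξ j ω ∂μ = 0)
    (hvar : ∀ j, variance (ξ j) μ = 1) (K : ℕ) {B : ℝ} (hB : 0 < B) :
    μ.real {ω | ∃ m ≤ K, B ≤ |∑ j ∈ Finset.range (m + 1), ξ j ω|} ≤ √(K + 1) / B := by
  set S : ℕ → Ω → ℝ := fun m => ∑ j ∈ Finset.range (m + 1), ξ j with hS
  have hsm : ∀ j, StronglyMeasurable (ξ j) := fun j => (hm j).stronglyMeasurable
  have hint : ∀ j, Integrable (ξ j) μ := fun j => (hL2 j).integrable (by norm_num)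
  have hSint : ∀ m, Integrable (S m) μ := fun m => integrable_finsetSum' _ fun j _ => hint j
  have hmart : Martingale S (Filtration.natural ξ hsm) μ := by
    refine martingale_of_condExp_sub_eq_zero_nat ?_ hSint ?_
    · intro m
      refine Finset.stronglyMeasurable_sum _ fun j hj => ?_
      have hjm : j ≤ m := by simpa [Nat.lt_succ_iff] using hj
      exact (Filtration.stronglyAdapted_natural hsm j).mono ((Filtration.natural ξ hsm).mono hjm)
    · intro m
      have e : S (m + 1) - S m = ξ (m + 1) := by
        simp only [hS]; rw [Finset.sum_range_succ]; simp
      rw [e]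
      refine (hind.condExp_natural_ae_eq_of_lt hsm (Nat.lt_succ_self m)).trans ?_
      simp [hmean]; rfl
  have hsub : Submartingale (S ⊔ (-S)) (Filtration.natural ξ hsm) μ :=
    hmart.submartingale.sup hmart.neg.submartingale
  have habs : ∀ m ω, (S ⊔ (-S)) m ω = |S m ω| := fun m ω => by
    simp [abs]
  have hmax := maximal_ineq hsub (fun m ω => by rw [habs]; exact abs_nonneg _) (ε := ⟨B, hB.le⟩) K
  set A := {ω | ((⟨B, hB.le⟩ : NNReal) : ℝ) ≤ (Finset.range (K + 1)).sup' Finset.nonempty_range_add_one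
    fun k => (S ⊔ (-S)) k ω} with hA
  have hset : {ω | ∃ m ≤ K, B ≤ |∑ j ∈ Finset.range (m + 1), ξ j ω|} ⊆ A := by
    rintro ω ⟨m, hmK, hBm⟩
    simp only [hA, Set.mem_ofPred_eq]
    rw [Finset.le_sup'_iff]
    refine ⟨m, by simp; omega, ?_⟩
    rw [habs]; simpa [hS] using hBm
  have habsint : Integrable (fun ω => |S K ω|) μ := (hSint K).abs
  have hSL2 : MemLp (S K) 2 μ := memLp_finsetSum' _ fun j _ => hL2 j
  have hES : ∫ ω, |S K ω| ∂μ ≤ √(K + 1) := by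
    have hv : variance (S K) μ = K + 1 := by
      simp only [hS]
      rw [IndepFun.variance_sum (fun j _ => hL2 j) (fun i _ j _ hij => hind.indepFun hij)]
      simp [hvar]
    have hES0 : ∫ ω, S K ω ∂μ = 0 := by
      simp only [hS, Finset.sum_apply]
      rw [integral_finsetSum _ fun j _ => hint j]; simp [hmean]
    rw [variance_eq_sub hSL2, hES0] at hv
    have h1 : 0 ≤ variance |S K| μ := variance_nonneg _ _
    rw [variance_eq_sub hSL2.abs] at h1
    apply Real.le_sqrt_of_sq_le
    have e : |S K| ^ 2 = (S K) ^ 2 := by ext ω; simp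
    rw [e] at h1
    simp only [Pi.abs_apply] at h1
    linarith
  have h2 : ENNReal.ofReal B * μ A ≤ ENNReal.ofReal (√(K + 1)) := by
    refine le_trans (le_of_eq_of_le ?_ hmax) (ENNReal.ofReal_le_ofReal ?_)
    · congr 1
      rw [ENNReal.ofReal]; congr 1; ext; rw [Real.coe_toNNReal _ hB.le]; rfl
    · simp_rw [habs]
      refine le_trans ?_ hES
      exact setIntegral_le_integral habsint (Filter.Eventually.of_forall fun ω => abs_nonneg _)
  rw [le_div_iff₀ hB]
  have h3 : B * μ.real A ≤ √(K + 1) := by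
    have := ENNReal.toReal_mono ENNReal.ofReal_ne_top h2
    rwa [ENNReal.toReal_mul, ENNReal.toReal_ofReal hB.le, ENNReal.toReal_ofReal (by positivity)]
      at this
  have := measureReal_mono (μ := μ) hset
  nlinarith

namespace Admissible

variable {Ω : Type*} [MeasurableSpace Ω] {μ : Measure Ω} [IsProbabilityMeasure μ]
  {ξ : ℕ → Ω → ℝ} {ε₀ M : ℝ}

lemma memLp_two (h : Admissible μ ξ ε₀ M) (hε₀ : 0 < ε₀) (j : ℕ) : MemLp (ξ j) 2 μ := by
  rw [memLp_two_iff_integrable_sq (h.measurable j).aestronglyMeasurable]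
  refine ((integrable_const (1 : ℝ)).add (h.integrable_moment j)).mono'
    ((h.measurable j).pow_const 2).aestronglyMeasurable (Filter.Eventually.of_forall fun ω => ?_)
  rw [Real.norm_eq_abs, abs_of_nonneg (sq_nonneg _), Pi.add_apply]
  rcases le_or_gt |ξ j ω| 1 with h1 | h1
  · have : 0 ≤ |ξ j ω| ^ (2 + ε₀) := by positivity
    have : ξ j ω ^ 2 ≤ 1 := (sq_le_one_iff_abs_le_one _).2 h1
    linarith
  · have : |ξ j ω| ^ (2:ℝ) ≤ |ξ j ω| ^ (2 + ε₀) :=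
      Real.rpow_le_rpow_of_exponent_le h1.le (by linarith)
    rw [Real.rpow_two, sq_abs] at this
    linarith

lemma integral_sq (h : Admissible μ ξ ε₀ M) (hε₀ : 0 < ε₀) (j : ℕ) : ∫ ω, ξ j ω ^ 2 ∂μ = 1 := by
  have hv := h.variance j
  rw [variance_eq_sub (h.memLp_two hε₀ j), h.mean j] at hv
  simpa using hv

end Admissible

/-! ### Concentration of sums of independent variables -/

lemma indepFun_sum_mul_sum_mul {Ω : Type*} [MeasurableSpace Ω] {μ : Measure Ω} {ξ : ℕ → Ω → ℝ}
    (hm : ∀ j, Measurable (ξ j)) (hind : iIndepFun ξ μ) (w : ℕ → ℝ)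
    {s t : Finset ℕ} (hst : Disjoint s t) :
    IndepFun (fun ω => ∑ j ∈ s, w j * ξ j ω) (fun ω => ∑ j ∈ t, w j * ξ j ω) μ := by
  have h := hind.indepFun_finset s t hst hm
  have h2 := h.comp (φ := fun v : s → ℝ => ∑ j : s, w j * v j) (ψ := fun v : t → ℝ => ∑ j : t, w j * v j)
    (Finset.measurable_sum _ fun j _ => (measurable_pi_apply j).const_mul _)
    (Finset.measurable_sum _ fun j _ => (measurable_pi_apply j).const_mul _)
  convert h2 using 1
  · ext ω; simp only [Function.comp]; exact (Finset.sum_coe_sort s (fun j => w j * ξ j ω)).symm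
  · ext ω; simp only [Function.comp]; exact (Finset.sum_coe_sort t (fun j => w j * ξ j ω)).symm

section Concentration

variable {Ω : Type*} [MeasurableSpace Ω] {μ : Measure Ω} [IsProbabilityMeasure μ]

/-- Conditioning on `X`: the event `X ∈ A` costs independently of the concentration of `Y`. -/
lemma IndepFun.measureReal_mem_and_abs_add_sub_le {X Y : Ω → ℝ} (hX : Measurable X)
    (hY : Measurable Y) (hXY : IndepFun X Y μ) {A : Set ℝ} (hA : MeasurableSet A) {r q : ℝ}
    (hq : ∀ b, μ.real {ω | |Y ω - b| ≤ r} ≤ q) (a : ℝ) :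
    μ.real {ω | X ω ∈ A ∧ |X ω + Y ω - a| ≤ r} ≤ μ.real {ω | X ω ∈ A} * q := by
  have hq0 : 0 ≤ q := measureReal_nonneg.trans (hq 0)
  set S : Set (ℝ × ℝ) := {p | p.1 ∈ A ∧ |p.1 + p.2 - a| ≤ r} with hS
  have hSm : MeasurableSet S := by
    refine (measurable_fst hA).inter ?_
    exact measurableSet_le (f := fun p : ℝ × ℝ => |p.1 + p.2 - a|) (by fun_prop) measurable_const
  have hmap := (indepFun_iff_map_prod_eq_prod_map_map hX.aemeasurable hY.aemeasurable).1 hXY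
  have h1 : μ {ω | X ω ∈ A ∧ |X ω + Y ω - a| ≤ r} = ((μ.map X).prod (μ.map Y)) S := by
    rw [← hmap, Measure.map_apply (hX.prodMk hY) hSm]; rfl
  have h2 : ((μ.map X).prod (μ.map Y)) S ≤ μ {ω | X ω ∈ A} * ENNReal.ofReal q := by
    rw [Measure.prod_apply hSm]
    have hle : ∀ x, (μ.map Y) (Prod.mk x ⁻¹' S) ≤ A.indicator (fun _ => ENNReal.ofReal q) x := by
      intro x
      by_cases hx : x ∈ A
      · rw [Set.indicator_of_mem hx]
        rw [Measure.map_apply hY (measurable_prodMk_left hSm)]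
        have hsub : Y ⁻¹' (Prod.mk x ⁻¹' S) ⊆ {ω | |Y ω - (a - x)| ≤ r} := by
          intro ω hω
          have := hω.2
          simp only [Set.mem_ofPred_eq] at this ⊢
          convert this using 2; ring
        refine (measure_mono hsub).trans ?_
        rw [← ENNReal.ofReal_toReal (measure_ne_top μ _)]
        exact ENNReal.ofReal_le_ofReal (hq _)
      · have : Prod.mk x ⁻¹' S = ∅ := by
          ext y; simp [hS, hx]
        rw [this]; simp
    refine (lintegral_mono hle).trans ?_
    rw [lintegral_indicator hA, setLIntegral_const, mul_comm, Measure.map_apply hX hA]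
    rfl
  rw [Measure.real, h1]
  refine (ENNReal.toReal_mono (by finiteness) h2).trans ?_
  rw [ENNReal.toReal_mul, ENNReal.toReal_ofReal hq0]; rfl

lemma IndepFun.measureReal_abs_add_sub_le {X Y : Ω → ℝ} (hX : Measurable X)
    (hY : Measurable Y) (hXY : IndepFun X Y μ) {r q : ℝ}
    (hq : ∀ b, μ.real {ω | |Y ω - b| ≤ r} ≤ q) (a : ℝ) :
    μ.real {ω | |X ω + Y ω - a| ≤ r} ≤ q := by
  have := IndepFun.measureReal_mem_and_abs_add_sub_le hX hY hXY MeasurableSet.univ hq a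
  simpa using this

lemma measureReal_abs_sub_le_nat_mul {X : Ω → ℝ} {δ Q : ℝ}
    (hQ : ∀ b, μ.real {ω | |X ω - b| ≤ δ} ≤ Q) (a : ℝ) (N : ℕ) (hN : 1 ≤ N) :
    μ.real {ω | |X ω - a| ≤ N * δ} ≤ N * Q := by
  induction N, hN using Nat.le_induction generalizing a with
  | base => simpa using hQ a
  | succ N hN ih =>
    -- a ball of radius `(N + 1) δ` is covered by one of radius `N δ` and one of radius `δ`
    have hsub : {ω | |X ω - a| ≤ (N + 1 : ℕ) * δ} ⊆
        {ω | |X ω - (a - δ)| ≤ N * δ} ∪ {ω | |X ω - (a + N * δ)| ≤ δ} := by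
      intro ω hω
      simp only [Set.mem_ofPred_eq, Set.mem_union, abs_le] at hω ⊢
      push_cast at hω
      by_cases hc : X ω ≤ a + (N - 1) * δ
      · left; constructor <;> linarith
      · right; push Not at hc; constructor <;> linarith
    refine (measureReal_mono hsub).trans ((measureReal_union_le _ _).trans ?_)
    have h1 := ih (a - δ)
    have h2 := hQ (a + N * δ)
    push_cast; linarith

/-- If `X` is spread at scale `δ` and `Y`, independent of `X` and rarely larger than `(N - 1) δ`, is
spread at a finer scale `r`, then `X + Y` is spread at scale `r` and the two bounds nearly multiply.
When `|X - a| ≤ N δ` one conditions on `X`, otherwise `Y` is large and one conditions on `Y`. -/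
lemma IndepFun.measureReal_abs_add_sub_le_mul {X Y : Ω → ℝ} (hX : Measurable X)
    (hY : Measurable Y) (hXY : IndepFun X Y μ) {δ r Q q s : ℝ} {N : ℕ} (hN : 1 ≤ N)
    (hrδ : r ≤ δ) (hQ : ∀ b, μ.real {ω | |X ω - b| ≤ δ} ≤ Q)
    (hq : ∀ b, μ.real {ω | |Y ω - b| ≤ r} ≤ q)
    (hs : μ.real {ω | (N - 1) * δ ≤ |Y ω|} ≤ s) (a : ℝ) :
    μ.real {ω | |X ω + Y ω - a| ≤ r} ≤ Q * (N * q + s) := by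
  have hQ0 : 0 ≤ Q := measureReal_nonneg.trans (hQ 0)
  have hq0 : 0 ≤ q := measureReal_nonneg.trans (hq 0)
  have hsub : {ω | |X ω + Y ω - a| ≤ r} ⊆
      {ω | X ω ∈ {x | |x - a| ≤ N * δ} ∧ |X ω + Y ω - a| ≤ r} ∪
      {ω | Y ω ∈ {y | (N - 1) * δ ≤ |y|} ∧ |Y ω + X ω - a| ≤ δ} := by
    intro ω hω
    simp only [Set.mem_ofPred_eq, Set.mem_union] at hω ⊢
    by_cases hc : |X ω - a| ≤ N * δ
    · exact Or.inl ⟨hc, hω⟩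
    · right
      push Not at hc
      constructor
      · have := abs_sub_abs_le_abs_sub (X ω - a) (-(Y ω))
        rw [abs_neg, show X ω - a - -Y ω = X ω + Y ω - a by ring] at this
        linarith
      · rw [add_comm (Y ω)]; linarith
  refine (measureReal_mono hsub).trans ((measureReal_union_le _ _).trans ?_)
  have h1 := IndepFun.measureReal_mem_and_abs_add_sub_le hX hY hXY (A := {x | |x - a| ≤ N * δ})
    (measurableSet_le (by fun_prop) measurable_const) hq a
  have h2 := IndepFun.measureReal_mem_and_abs_add_sub_le hY hX hXY.symm
    (A := {y | (N - 1) * δ ≤ |y|}) (measurableSet_le measurable_const (by fun_prop)) hQ a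
  have h3 : μ.real {ω | X ω ∈ {x | |x - a| ≤ N * δ}} ≤ N * Q :=
    measureReal_abs_sub_le_nat_mul hQ a N hN
  have h4 : μ.real {ω | Y ω ∈ {y | (N - 1) * δ ≤ |y|}} ≤ s := hs
  nlinarith [mul_le_mul_of_nonneg_right h3 hq0, mul_le_mul_of_nonneg_right h4 hQ0]

variable {ξ : ℕ → Ω → ℝ}

/-- Concentration of a weighted sum with weights at most `lam`. -/
lemma measureReal_abs_sum_mul_sub_le (hm : ∀ j, Measurable (ξ j)) (hind : iIndepFun ξ μ)
    {t₀ : ℝ} (ht₀ : 0 < t₀)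
    (hchar : ∀ j t, |t| ≤ t₀ → ‖charFun (μ.map (ξ j)) t‖ ≤ Real.exp (-(t ^ 2 / 4)))
    (s : Finset ℕ) (w : ℕ → ℝ) {lam : ℝ} (hlam : 0 < lam) (hw : ∀ j ∈ s, |w j| ≤ lam)
    (hV : 0 < ∑ j ∈ s, w j ^ 2) (a : ℝ) {δ : ℝ} (hδ : 0 < δ) :
    μ.real {ω | |∑ j ∈ s, w j * ξ j ω - a| ≤ δ}
      ≤ 4 * (δ / √(∑ j ∈ s, w j ^ 2)) + 2 / (t₀ / lam * δ) ^ 2 := by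
  have hYm : Measurable (fun ω => ∑ j ∈ s, w j * ξ j ω) := by fun_prop
  have hind2 : iIndepFun (fun j ω => w j * ξ j ω) μ :=
    hind.comp (fun j x => w j * x) (fun j => by fun_prop)
  have hcf : charFun (μ.map (fun ω => ∑ j ∈ s, w j * ξ j ω))
      = ∏ j ∈ s, charFun (μ.map (fun ω => w j * ξ j ω)) :=
    iIndepFun.charFun_map_fun_finsetSum_eq_prod (fun j _ => ((hm j).const_mul (w j)).aemeasurable)
      (iIndepFun.precomp (g := ((↑) : s → ℕ)) Subtype.val_injective hind2)
  have : IsProbabilityMeasure (μ.map (fun ω => ∑ j ∈ s, w j * ξ j ω)) :=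
    Measure.isProbabilityMeasure_map hYm.aemeasurable
  have hmain := measureReal_abs_sub_le_of_charFun_le
    (μ.map (fun ω => ∑ j ∈ s, w j * ξ j ω)) (t₀ := t₀ / lam) (by positivity) hV ?_ a hδ
  · rw [map_measureReal_apply hYm (measurableSet_le (by fun_prop) measurable_const)] at hmain
    exact hmain
  · intro t ht
    rw [hcf, Finset.prod_apply, norm_prod]
    have hj : ∀ j ∈ s, ‖charFun (μ.map (fun ω => w j * ξ j ω)) t‖
        ≤ Real.exp (-((w j * t) ^ 2 / 4)) := by
      intro j hj
      rw [charFun_map_mul_comp (hm j).aemeasurable]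
      apply hchar
      rw [abs_mul]
      calc |w j| * |t| ≤ lam * (t₀ / lam) := by gcongr; exact hw j hj
        _ = t₀ := by field_simp
    refine (Finset.prod_le_prod (fun j _ => norm_nonneg _) hj).trans (le_of_eq ?_)
    rw [← Real.exp_sum]
    congr 1
    rw [Finset.sum_neg_distrib, ← Finset.sum_div, Finset.sum_mul]
    simp_rw [mul_pow]

/-- Chebyshev's inequality for weighted sums. -/
lemma measureReal_le_abs_sum_mul_le (hind : iIndepFun ξ μ) (hL2 : ∀ j, MemLp (ξ j) 2 μ)
    (hmean : ∀ j, ∫ ω, ξ j ω ∂μ = 0) (hvar : ∀ j, variance (ξ j) μ = 1)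
    (s : Finset ℕ) (w : ℕ → ℝ) {c : ℝ} (hc : 0 < c) :
    μ.real {ω | c ≤ |∑ j ∈ s, w j * ξ j ω|} ≤ (∑ j ∈ s, w j ^ 2) / c ^ 2 := by
  have hind2 : iIndepFun (fun j ω => w j * ξ j ω) μ :=
    hind.comp (fun j x => w j * x) (fun j => by fun_prop)
  have hL : ∀ j, MemLp (fun ω => w j * ξ j ω) 2 μ := fun j => (hL2 j).const_mul (w j)
  have hS : MemLp (∑ j ∈ s, fun ω => w j * ξ j ω) 2 μ := memLp_finsetSum' _ fun j _ => hL j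
  have hE : ∫ ω, (∑ j ∈ s, fun ω => w j * ξ j ω) ω ∂μ = 0 := by
    simp only [Finset.sum_apply]
    rw [integral_finsetSum _ fun j _ => (hL j).integrable (by norm_num)]
    simp [integral_const_mul, hmean]
  have hV : variance (∑ j ∈ s, fun ω => w j * ξ j ω) μ = ∑ j ∈ s, w j ^ 2 := by
    rw [IndepFun.variance_sum (fun j _ => hL j) (fun i _ j _ hij => hind2.indepFun hij)]
    refine Finset.sum_congr rfl fun j _ => ?_
    rw [variance_const_mul, hvar, mul_one]
  have h := meas_ge_le_variance_div_sq hS hc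
  rw [hE, hV] at h
  have h2 := ENNReal.toReal_mono ENNReal.ofReal_ne_top h
  rw [ENNReal.toReal_ofReal (by positivity)] at h2
  simpa [Measure.real] using h2

/-- One geometric block at a time: with blocks of length `L`, ratio `ρ = u ^ L` small enough and `u`
close enough to `1`, each further block multiplies the concentration at the correspondingly smaller
scale by at most `ρ ^ (3/5)`. The exponent only has to exceed `1/2`. -/
lemma measureReal_abs_sum_blocks_sub_le (hm : ∀ j, Measurable (ξ j)) (hind : iIndepFun ξ μ)
    (hL2 : ∀ j, MemLp (ξ j) 2 μ)
    (hmean : ∀ j, ∫ ω, ξ j ω ∂μ = 0) (hvar : ∀ j, variance (ξ j) μ = 1)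
    {t₀ : ℝ} (ht₀ : 0 < t₀)
    (hchar : ∀ j t, |t| ≤ t₀ → ‖charFun (μ.map (ξ j)) t‖ ≤ Real.exp (-(t ^ 2 / 4)))
    {u : ℝ} (hu0 : 0 < u) (hu1 : u < 1) {L : ℕ} (hρ : (u ^ L) ^ (1 / 15 : ℝ) ≤ 1 / 28)
    (hσ : 2 / (t₀ ^ 2 * (u ^ L) ^ 3) ≤ 1 / (1 - u)) (T : ℕ) (a : ℝ) :
    μ.real {ω | |∑ j ∈ Finset.range (T * L), u ^ j * ξ j ω - a| ≤ (√(1 - u))⁻¹ * (u ^ L) ^ T}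
      ≤ ((u ^ L) ^ (3 / 5 : ℝ)) ^ T := by
  set ρ := u ^ L with hρdef
  have hρ0 : 0 < ρ := by positivity
  have h1u : 0 < 1 - u := by linarith
  set σ := (√(1 - u))⁻¹ with hσdef
  have hσ0 : 0 < σ := by rw [hσdef]; have := Real.sqrt_pos.2 h1u; positivity
  have hσsq : σ ^ 2 = 1 / (1 - u) := by rw [hσdef, inv_pow, Real.sq_sqrt h1u.le, one_div]
  have hρ1 : ρ ≤ 1 / 28 := by
    have h15 : (ρ ^ (1 / 15 : ℝ)) ^ (15:ℕ) = ρ := by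
      rw [← Real.rpow_natCast, ← Real.rpow_mul hρ0.le]; norm_num
    have h0 : 0 ≤ ρ ^ (1 / 15 : ℝ) := by positivity
    rw [← h15]
    calc (ρ ^ (1 / 15 : ℝ)) ^ 15 ≤ (1 / 28) ^ 15 := by gcongr
      _ ≤ 1 / 28 := by norm_num
  induction T generalizing a with
  | zero => simp
  | succ T ih =>
    set lam := ρ ^ T with hlam
    have hlam0 : 0 < lam := by positivity
    set s := Finset.Ico (T * L) ((T + 1) * L) with hs
    have hdisj : Disjoint (Finset.range (T * L)) s := by
      rw [Finset.range_eq_Ico]; exact Finset.Ico_disjoint_Ico_consecutive _ _ _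
    have hindXY := indepFun_sum_mul_sum_mul hm hind (fun j => u ^ j) hdisj
    have hpow : ∀ i, u ^ (T * L + i) = lam * u ^ i := by
      intro i; rw [pow_add, hlam, hρdef, ← pow_mul, mul_comm L T]
    have hVeq : ∑ j ∈ s, (u ^ j) ^ 2 = lam ^ 2 * ((1 - ρ ^ 2) / (1 - u ^ 2)) := by
      rw [hs, Finset.sum_Ico_eq_sum_range, show (T + 1) * L - T * L = L by
        rw [add_mul, one_mul]; omega]
      have e : ∀ i, (u ^ (T * L + i)) ^ 2 = lam ^ 2 * (u ^ 2) ^ i := by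
        intro i; rw [hpow, mul_pow, pow_right_comm u i 2]
      simp_rw [e]
      rw [← Finset.mul_sum, geom_sum_eq (by nlinarith)]
      congr 1
      rw [← neg_div_neg_eq, neg_sub, neg_sub, ← pow_mul, mul_comm 2 L, pow_mul]
    have hden : 0 < 1 - u ^ 2 := by nlinarith
    have hVlow : lam ^ 2 * (σ ^ 2 / 4) ≤ ∑ j ∈ s, (u ^ j) ^ 2 := by
      rw [hVeq, hσsq]
      refine mul_le_mul_of_nonneg_left ?_ (by positivity)
      rw [div_div, div_le_div_iff₀ (by positivity) hden]
      have : ρ ^ 2 ≤ 1 / 2 := by nlinarith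
      nlinarith
    have hVup : ∑ j ∈ s, (u ^ j) ^ 2 ≤ lam ^ 2 * σ ^ 2 := by
      rw [hVeq, hσsq]
      gcongr
      · nlinarith [sq_nonneg ρ]
      · nlinarith
    have hV0 : 0 < ∑ j ∈ s, (u ^ j) ^ 2 := lt_of_lt_of_le (by positivity) hVlow
    -- the concentration of the new block
    have hq : ∀ b, μ.real {ω | |∑ j ∈ s, u ^ j * ξ j ω - b| ≤ σ * ρ ^ (T + 1)} ≤ 9 * ρ := by
      intro b
      have h := measureReal_abs_sum_mul_sub_le hm hind ht₀ hchar s (fun j => u ^ j) hlam0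
        (fun j hj => by
          rw [abs_of_pos (by positivity)]
          have hj' := (Finset.mem_Ico.1 hj).1
          obtain ⟨i, rfl⟩ := Nat.exists_eq_add_of_le hj'
          rw [hpow]
          exact mul_le_of_le_one_right hlam0.le (pow_le_one₀ hu0.le hu1.le)) hV0 b
        (δ := σ * ρ ^ (T + 1)) (by positivity)
      refine h.trans ?_
      have h1 : σ * ρ ^ (T + 1) / √(∑ j ∈ s, (u ^ j) ^ 2) ≤ 2 * ρ := by
        have : lam * σ / 2 ≤ √(∑ j ∈ s, (u ^ j) ^ 2) := by
          apply Real.le_sqrt_of_sq_le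
          refine le_trans (le_of_eq ?_) hVlow; ring
        rw [div_le_iff₀ (Real.sqrt_pos.2 hV0), pow_succ, ← hlam]
        calc σ * (lam * ρ) = 2 * ρ * (lam * σ / 2) := by ring
          _ ≤ _ := by gcongr
      have h2 : 2 / (t₀ / lam * (σ * ρ ^ (T + 1))) ^ 2 ≤ ρ := by
        have e : t₀ / lam * (σ * ρ ^ (T + 1)) = t₀ * σ * ρ := by
          rw [pow_succ, ← hlam]; field_simp
        rw [e, mul_pow, mul_pow, div_le_iff₀ (by positivity)]
        rw [← hσsq, div_le_iff₀ (by positivity)] at hσ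
        nlinarith
      linarith
    -- the number of cells of the previous scale that are kept
    set N := ⌈ρ ^ (-(1 / 3) : ℝ)⌉₊ + 1 with hN
    have hr0 : 0 < ρ ^ (-(1 / 3) : ℝ) := by positivity
    have hr1 : 1 ≤ ρ ^ (-(1 / 3) : ℝ) :=
      Real.one_le_rpow_of_pos_of_le_one_of_nonpos hρ0 (by linarith) (by norm_num)
    have hNlow : ρ ^ (-(1 / 3) : ℝ) ≤ (N : ℝ) - 1 := by
      rw [hN]; push_cast; simpa using Nat.le_ceil _
    have hNup : (N : ℝ) ≤ 3 * ρ ^ (-(1 / 3) : ℝ) := by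
      have := Nat.ceil_lt_add_one hr0.le
      rw [hN]; push_cast; linarith
    have hs2 : μ.real {ω | ((N : ℝ) - 1) * (σ * ρ ^ T) ≤ |∑ j ∈ s, u ^ j * ξ j ω|}
        ≤ ρ ^ (2 / 3 : ℝ) := by
      refine (measureReal_le_abs_sum_mul_le hind hL2 hmean hvar s (fun j => u ^ j)
        (c := ((N : ℝ) - 1) * (σ * ρ ^ T)) ?_).trans ?_
      · have : 0 < (N : ℝ) - 1 := by linarith
        positivity
      · have hN1 : 0 < (N : ℝ) - 1 := by linarith
        rw [div_le_iff₀ (by positivity)]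
        refine hVup.trans ?_
        have h1 : 1 ≤ ρ ^ (2 / 3 : ℝ) * ((N : ℝ) - 1) ^ 2 := by
          calc (1:ℝ) = ρ ^ (2 / 3 : ℝ) * (ρ ^ (-(1 / 3) : ℝ)) ^ 2 := by
                rw [← Real.rpow_natCast, ← Real.rpow_mul hρ0.le, ← Real.rpow_add hρ0]; norm_num
            _ ≤ _ := by gcongr
        rw [← hlam]
        calc lam ^ 2 * σ ^ 2 = (lam ^ 2 * σ ^ 2) * 1 := by ring
          _ ≤ (lam ^ 2 * σ ^ 2) * (ρ ^ (2 / 3 : ℝ) * ((N : ℝ) - 1) ^ 2) := by gcongr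
          _ = _ := by ring
    have hstep := IndepFun.measureReal_abs_add_sub_le_mul (by fun_prop) (by fun_prop) hindXY
      (N := N) (by omega)
      (by
        rw [pow_succ, ← mul_assoc]
        exact mul_le_of_le_one_right (by positivity) (by linarith)) ih hq hs2 a
    have hsum : ∀ ω, ∑ j ∈ Finset.range ((T + 1) * L), u ^ j * ξ j ω
        = ∑ j ∈ Finset.range (T * L), u ^ j * ξ j ω + ∑ j ∈ s, u ^ j * ξ j ω := by
      intro ω
      rw [hs, Finset.sum_range_add_sum_Ico _ (by gcongr; omega)]
    simp_rw [hsum]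
    refine hstep.trans ?_
    rw [pow_succ]
    gcongr
    have e1 : ρ ^ (-(1 / 3) : ℝ) * ρ = ρ ^ (2 / 3 : ℝ) := by
      nth_rewrite 2 [← Real.rpow_one ρ]
      rw [← Real.rpow_add hρ0]; norm_num
    have e2 : ρ ^ (2 / 3 : ℝ) = ρ ^ (1 / 15 : ℝ) * ρ ^ (3 / 5 : ℝ) := by
      rw [← Real.rpow_add hρ0]; norm_num
    have h3 : 0 < ρ ^ (3 / 5 : ℝ) := by positivity
    have h4 : (N : ℝ) * (9 * ρ) ≤ 27 * ρ ^ (2 / 3 : ℝ) := by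
      rw [← e1]; nlinarith
    have h5 : 28 * ρ ^ (2 / 3 : ℝ) ≤ ρ ^ (3 / 5 : ℝ) := by
      rw [e2]; nlinarith
    linarith

end Concentration

lemma eval_kacPoly {Ω : Type*} (ξ : ℕ → Ω → ℝ) (n : ℕ) (ω : Ω) (x : ℝ) :
    (kacPoly ξ n ω).eval x = ∑ j ∈ Finset.range (n + 1), x ^ j * ξ j ω := by
  rw [kacPoly, eval_finsetSum]
  refine Finset.sum_congr rfl fun j _ => ?_
  rw [eval_mul, eval_C, eval_pow, eval_X, mul_comm]

/-- **Small-ball estimate at all scales.** Close to `1`, the value `p_n(u)` has the size of its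
standard deviation `(1 - u) ^ (-1/2)`, and is smaller by a factor `u ^ m`, `m ≤ n`, with probability
at most of order `u ^ (3 m / 5)`. -/
lemma exists_measureReal_abs_eval_le (ε₀ M : ℝ) (hε₀ : 0 < ε₀) :
    ∃ C κ : ℝ, 0 < C ∧ 0 < κ ∧ κ ≤ 1 / 2 ∧
      ∀ (Ω : Type*) [MeasurableSpace Ω] (μ : Measure Ω) [IsProbabilityMeasure μ]
        (ξ : ℕ → Ω → ℝ), Admissible μ ξ ε₀ M → ∀ u : ℝ, 1 - κ ≤ u → u < 1 →
        ∀ (n : ℕ) (m : ℝ), 0 ≤ m → m ≤ n →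
          μ.real {ω | |(kacPoly ξ n ω).eval u| ≤ (√(1 - u))⁻¹ * u ^ m} ≤ C * u ^ (3 / 5 * m) := by
  obtain ⟨t₀, ht₀, H⟩ := exists_norm_charFun_le ε₀ M hε₀
  refine ⟨Real.exp 122, min (1 / 2) (t₀ ^ 2 * Real.exp (-122) ^ 3 / 2), Real.exp_pos _,
    by positivity, min_le_left _ _, ?_⟩
  intro Ω _ μ _ ξ hξ u huκ hu1 n m hm0 hmn
  have hu2 : 1 / 2 ≤ u := by
    have := min_le_left (1 / 2 : ℝ) (t₀ ^ 2 * Real.exp (-122) ^ 3 / 2); linarith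
  have hu3 : 1 - u ≤ t₀ ^ 2 * Real.exp (-122) ^ 3 / 2 := by
    have := min_le_right (1 / 2 : ℝ) (t₀ ^ 2 * Real.exp (-122) ^ 3 / 2); linarith
  have hu0 : 0 < u := by linarith
  have h1u : 0 < 1 - u := by linarith
  have hchar : ∀ j t, |t| ≤ t₀ → ‖charFun (μ.map (ξ j)) t‖ ≤ Real.exp (-(t ^ 2 / 4)) := fun j =>
    H Ω μ (ξ j) (hξ.measurable j) (hξ.mean j) (hξ.memLp_two hε₀ j) (hξ.integral_sq hε₀ j)
      (hξ.integrable_moment j) (hξ.moment_le j)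
  set L := ⌈60 / (1 - u)⌉₊ with hL
  have hLlow : 60 ≤ L * (1 - u) := by
    have := Nat.le_ceil (60 / (1 - u)); rwa [div_le_iff₀ h1u] at this
  have hLup : L * (1 - u) ≤ 61 := by
    have h := Nat.ceil_lt_add_one (show 0 ≤ 60 / (1 - u) by positivity)
    rw [← hL] at h
    have : (L : ℝ) * (1 - u) ≤ (60 / (1 - u) + 1) * (1 - u) := by gcongr
    have e : (60 / (1 - u) + 1) * (1 - u) = 60 + (1 - u) := by field_simp
    linarith
  have hL0 : 0 < L := by
    rcases Nat.eq_zero_or_pos L with h | h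
    · rw [h] at hLlow; norm_num at hLlow
    · exact h
  -- `ρ = u ^ L` lies between `exp (-122)` and `exp (-60)`
  have hulog : Real.log u ≤ -(1 - u) := by have := Real.log_le_sub_one_of_pos hu0; linarith
  have hulog2 : -(2 * (1 - u)) ≤ Real.log u := by
    have := Real.one_sub_inv_le_log_of_pos hu0
    have h2 : u⁻¹ ≤ 1 + 2 * (1 - u) := by
      rw [inv_le_iff_one_le_mul₀ hu0]; nlinarith
    linarith
  have hρexp : u ^ L = Real.exp (L * Real.log u) := by
    rw [mul_comm, Real.exp_mul, Real.exp_log hu0, Real.rpow_natCast]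
  have hρup : u ^ L ≤ Real.exp (-60) := by
    rw [hρexp]; apply Real.exp_le_exp.2
    have : (L : ℝ) * Real.log u ≤ L * (-(1 - u)) := by gcongr
    linarith
  have hρlow : Real.exp (-122) ≤ u ^ L := by
    rw [hρexp]; apply Real.exp_le_exp.2
    have : (L : ℝ) * (-(2 * (1 - u))) ≤ L * Real.log u := by gcongr
    linarith
  have hρ0 : 0 < u ^ L := by positivity
  have hρ15 : (u ^ L) ^ (1 / 15 : ℝ) ≤ 1 / 28 := by
    calc (u ^ L) ^ (1 / 15 : ℝ) ≤ (Real.exp (-60)) ^ (1 / 15 : ℝ) := by gcongr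
      _ = (Real.exp (-1)) ^ 4 := by
        rw [← Real.exp_mul, ← Real.exp_nat_mul]; norm_num
      _ ≤ (0.368) ^ 4 := by
        gcongr
        have := Real.exp_neg_one_lt_d9; linarith
      _ ≤ 1 / 28 := by norm_num
  have hσ : 2 / (t₀ ^ 2 * (u ^ L) ^ 3) ≤ 1 / (1 - u) := by
    rw [div_le_div_iff₀ (by positivity) h1u]
    have : t₀ ^ 2 * Real.exp (-122) ^ 3 ≤ t₀ ^ 2 * (u ^ L) ^ 3 := by gcongr
    linarith
  set T := ⌊m / L⌋₊ with hT
  have hL0' : (0:ℝ) < L := by exact_mod_cast hL0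
  have hTL : (T : ℝ) * L ≤ m := by
    have := Nat.floor_le (show 0 ≤ m / L by positivity); rwa [← hT, le_div_iff₀ hL0'] at this
  have hTL2 : m ≤ (T : ℝ) * L + L := by
    have := Nat.lt_floor_add_one (m / L)
    rw [← hT, div_lt_iff₀ hL0'] at this; linarith
  have hTLn : T * L ≤ n + 1 := by
    have : ((T * L : ℕ) : ℝ) ≤ n := by push_cast; linarith
    have := Nat.cast_le.1 this; omega
  have hpowT : (u ^ L) ^ T = u ^ ((T : ℝ) * L) := by
    rw [← pow_mul, mul_comm L T, ← Real.rpow_natCast]; push_cast; rfl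
  have hblock := measureReal_abs_sum_blocks_sub_le hξ.measurable hξ.indep (hξ.memLp_two hε₀) hξ.mean
    hξ.variance ht₀ hchar hu0 hu1 hρ15 hσ T
  have hind := (indepFun_sum_mul_sum_mul hξ.measurable hξ.indep (fun j => u ^ j)
    (s := Finset.range (T * L)) (t := Finset.Ico (T * L) (n + 1))
    (by rw [Finset.range_eq_Ico]; exact Finset.Ico_disjoint_Ico_consecutive _ _ _)).symm
  have hX : ∀ s : Finset ℕ, Measurable (fun ω => ∑ j ∈ s, u ^ j * ξ j ω) := fun s =>
    Finset.measurable_sum _ fun j _ => (hξ.measurable j).const_mul _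
  have h1 := IndepFun.measureReal_abs_add_sub_le (hX _) (hX _) hind hblock 0
  have hsub : {ω | |(kacPoly ξ n ω).eval u| ≤ (√(1 - u))⁻¹ * u ^ m} ⊆
      {ω | |∑ j ∈ Finset.Ico (T * L) (n + 1), u ^ j * ξ j ω
        + ∑ j ∈ Finset.range (T * L), u ^ j * ξ j ω - 0| ≤ (√(1 - u))⁻¹ * (u ^ L) ^ T} := by
    intro ω hω
    simp only [Set.mem_ofPred_eq] at hω ⊢
    rw [sub_zero, add_comm, Finset.sum_range_add_sum_Ico _ hTLn, ← eval_kacPoly]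
    refine hω.trans ?_
    gcongr
    rw [hpowT]
    exact Real.rpow_le_rpow_of_exponent_ge hu0 hu1.le hTL
  refine (measureReal_mono hsub).trans (h1.trans ?_)
  rw [← Real.rpow_natCast, ← Real.rpow_mul hρ0.le, ← Real.rpow_natCast u L, ← Real.rpow_mul hu0.le]
  have e : (L : ℝ) * (3 / 5 * T) = -(3 / 5 * (m - T * L)) + 3 / 5 * m := by ring
  rw [e, Real.rpow_add hu0]
  gcongr
  rw [Real.rpow_neg hu0.le, ← one_div, div_le_iff₀ (by positivity)]
  have h2 : Real.exp (-122) ≤ u ^ (3 / 5 * (m - T * L)) := by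
    refine hρlow.trans ?_
    rw [← Real.rpow_natCast u L]
    exact Real.rpow_le_rpow_of_exponent_ge hu0 hu1.le (by linarith)
  calc (1:ℝ) = Real.exp 122 * Real.exp (-122) := by rw [← Real.exp_add]; norm_num
    _ ≤ _ := by gcongr

/-! ### Size of a polynomial in terms of the partial sums of its coefficients -/

/-- The polynomial `x₀ + x₁ X + ⋯ + x_k X ^ k` with deterministic coefficients; by
definition `kacPoly ξ k ω` is `coeffPoly (fun j => ξ j ω) k`. -/
noncomputable def coeffPoly (x : ℕ → ℝ) (k : ℕ) : ℝ[X] :=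
  ∑ j ∈ Finset.range (k + 1), C (x j) * X ^ j

lemma eval_coeffPoly (x : ℕ → ℝ) (k : ℕ) (u : ℝ) :
    (coeffPoly x k).eval u = ∑ j ∈ Finset.range (k + 1), x j * u ^ j := by
  simp [coeffPoly, eval_finsetSum]

lemma aeval_coeffPoly (x : ℕ → ℝ) (k : ℕ) (z : ℂ) :
    aeval z (coeffPoly x k) = ∑ j ∈ Finset.range (k + 1), (x j : ℂ) * z ^ j := by
  simp [coeffPoly]

lemma aeval_ofReal_eq (p : ℝ[X]) (u : ℝ) : aeval (u : ℂ) p = ((p.eval u : ℝ) : ℂ) := by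
  have := Polynomial.aeval_algebraMap_apply ℂ u p
  simpa using this

/-- Summation by parts. -/
lemma norm_aeval_coeffPoly_le {x : ℕ → ℝ} {K : ℕ} {B : ℝ}
    (hB : ∀ m ≤ K, |∑ j ∈ Finset.range (m + 1), x j| ≤ B) {k : ℕ} (hk : k ≤ K) (z : ℂ) :
    ‖aeval z (coeffPoly x k)‖ ≤ B * (‖z‖ ^ k + ‖1 - z‖ * ∑ j ∈ Finset.range k, ‖z‖ ^ j) := by
  have key : ∀ k ≤ K, ‖aeval z (coeffPoly x k)
      - ((∑ j ∈ Finset.range (k + 1), x j : ℝ) : ℂ) * z ^ k‖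
      ≤ B * (‖1 - z‖ * ∑ j ∈ Finset.range k, ‖z‖ ^ j) := by
    intro k
    induction k with
    | zero => intro _; simp [aeval_coeffPoly]
    | succ k ih =>
      intro hk
      have h1 := ih (by omega)
      have h2 := hB k (by omega)
      have e : aeval z (coeffPoly x (k + 1))
          - ((∑ j ∈ Finset.range (k + 1 + 1), x j : ℝ) : ℂ) * z ^ (k + 1)
          = (aeval z (coeffPoly x k) - ((∑ j ∈ Finset.range (k + 1), x j : ℝ) : ℂ) * z ^ k)
            + ((∑ j ∈ Finset.range (k + 1), x j : ℝ) : ℂ) * z ^ k * (1 - z) := by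
        rw [aeval_coeffPoly, aeval_coeffPoly, Finset.sum_range_succ _ (k + 1),
          Finset.sum_range_succ (fun j => x j) (k + 1)]
        push_cast; ring
      rw [e, Finset.sum_range_succ (fun j => ‖z‖ ^ j) k]
      refine (norm_add_le _ _).trans ?_
      have h3 : ‖((∑ j ∈ Finset.range (k + 1), x j : ℝ) : ℂ) * z ^ k * (1 - z)‖
          ≤ B * (‖z‖ ^ k * ‖1 - z‖) := by
        rw [norm_mul, norm_mul, norm_pow, Complex.norm_real, Real.norm_eq_abs, mul_assoc]
        gcongr
      linarith
  have h1 := key k hk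
  have h2 := norm_le_norm_add_norm_sub' (aeval z (coeffPoly x k))
    (((∑ j ∈ Finset.range (k + 1), x j : ℝ) : ℂ) * z ^ k)
  have h3 : ‖((∑ j ∈ Finset.range (k + 1), x j : ℝ) : ℂ) * z ^ k‖ ≤ B * ‖z‖ ^ k := by
    rw [norm_mul, norm_pow, Complex.norm_real, Real.norm_eq_abs]
    gcongr
    exact hB k hk
  linarith

lemma norm_aeval_coeffPoly_le_of_norm_lt_one {x : ℕ → ℝ} {K : ℕ} {B : ℝ} (hB0 : 0 ≤ B)
    (hB : ∀ m ≤ K, |∑ j ∈ Finset.range (m + 1), x j| ≤ B) {k : ℕ} (hk : k ≤ K) {z : ℂ}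
    (hz : ‖z‖ < 1) :
    ‖aeval z (coeffPoly x k)‖ ≤ B * (1 + ‖1 - z‖ / (1 - ‖z‖)) := by
  refine (norm_aeval_coeffPoly_le hB hk z).trans ?_
  rw [div_eq_mul_inv]
  gcongr
  · exact pow_le_one₀ (norm_nonneg _) hz.le
  · rw [← tsum_geometric_of_lt_one (norm_nonneg _) hz]
    exact (summable_geometric_of_lt_one (norm_nonneg _) hz).sum_le_tsum _
      fun i _ => by positivity

lemma norm_aeval_coeffPoly_le_exp {x : ℕ → ℝ} {K : ℕ} {B : ℝ} (hB0 : 0 ≤ B)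
    (hB : ∀ m ≤ K, |∑ j ∈ Finset.range (m + 1), x j| ≤ B) {k : ℕ} (hk : k ≤ K) {z : ℂ} {d : ℝ}
    (hz : ‖z - 1‖ ≤ d) :
    ‖aeval z (coeffPoly x k)‖ ≤ B * Real.exp (2 * (d * K)) := by
  refine (norm_aeval_coeffPoly_le hB hk z).trans ?_
  have hd : 0 ≤ d := (norm_nonneg _).trans hz
  have h1 : ‖z‖ ≤ Real.exp d := by
    have h := norm_add_le (z - 1) 1
    rw [sub_add_cancel, norm_one] at h
    have := Real.add_one_le_exp d
    linarith
  have hpow : ∀ j ≤ K, ‖z‖ ^ j ≤ Real.exp (d * K) := by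
    intro j hj
    calc ‖z‖ ^ j ≤ Real.exp d ^ j := by gcongr
      _ = Real.exp (d * j) := by rw [← Real.exp_nat_mul, mul_comm]
      _ ≤ Real.exp (d * K) := by gcongr
  have hsum : ∑ j ∈ Finset.range k, ‖z‖ ^ j ≤ K * Real.exp (d * K) := by
    calc ∑ j ∈ Finset.range k, ‖z‖ ^ j ≤ ∑ j ∈ Finset.range k, Real.exp (d * K) :=
          Finset.sum_le_sum fun j hj => hpow j (by have := Finset.mem_range.1 hj; omega)
      _ = k * Real.exp (d * K) := by simp
      _ ≤ _ := by gcongr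
  rw [norm_sub_rev] at hz
  have h2 : ‖z‖ ^ k + ‖1 - z‖ * ∑ j ∈ Finset.range k, ‖z‖ ^ j
      ≤ Real.exp (d * K) * (d * K + 1) := by
    have : ‖1 - z‖ * ∑ j ∈ Finset.range k, ‖z‖ ^ j ≤ d * (K * Real.exp (d * K)) := by gcongr
    have := hpow k hk
    linarith
  gcongr
  refine h2.trans ?_
  rw [two_mul, Real.exp_add]
  gcongr
  exact Real.add_one_le_exp _

/-- Inside `[0, 1]` the polynomials of degrees `n` and `k ≥ n` differ by at most `2 B u ^ n`. -/
lemma abs_eval_coeffPoly_sub_le {x : ℕ → ℝ} {K : ℕ} {B : ℝ}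
    (hB : ∀ m ≤ K, |∑ j ∈ Finset.range (m + 1), x j| ≤ B) {n k : ℕ} (hnk : n ≤ k) (hk : k ≤ K)
    {u : ℝ} (hu0 : 0 ≤ u) (hu1 : u ≤ 1) :
    |(coeffPoly x k).eval u - (coeffPoly x n).eval u| ≤ 2 * B * u ^ n := by
  have key : ∀ k, n ≤ k → k ≤ K → |(coeffPoly x k).eval u - (coeffPoly x n).eval u
      - (∑ j ∈ Finset.range (k + 1), x j) * u ^ k + (∑ j ∈ Finset.range (n + 1), x j) * u ^ n|
      ≤ B * (u ^ n - u ^ k) := by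
    intro k hnk
    induction k, hnk using Nat.le_induction with
    | base => intro _; simp
    | succ k hnk ih =>
      intro hk
      have h1 := ih (by omega)
      have h2 := hB k (by omega)
      have e : (coeffPoly x (k + 1)).eval u - (coeffPoly x n).eval u
          - (∑ j ∈ Finset.range (k + 1 + 1), x j) * u ^ (k + 1)
          + (∑ j ∈ Finset.range (n + 1), x j) * u ^ n
          = ((coeffPoly x k).eval u - (coeffPoly x n).eval u
            - (∑ j ∈ Finset.range (k + 1), x j) * u ^ k + (∑ j ∈ Finset.range (n + 1), x j) * u ^ n)
            + (∑ j ∈ Finset.range (k + 1), x j) * (u ^ k - u ^ (k + 1)) := by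
        rw [eval_coeffPoly x (k + 1), eval_coeffPoly x k, Finset.sum_range_succ _ (k + 1),
          Finset.sum_range_succ (fun j => x j) (k + 1)]
        ring
      rw [e]
      refine (abs_add_le _ _).trans ?_
      have h0 : 0 ≤ u ^ k - u ^ (k + 1) := by
        rw [pow_succ]; nlinarith [pow_nonneg hu0 k]
      have h3 : |(∑ j ∈ Finset.range (k + 1), x j) * (u ^ k - u ^ (k + 1))|
          ≤ B * (u ^ k - u ^ (k + 1)) := by
        rw [abs_mul, abs_of_nonneg h0]
        gcongr
      linarith
  have h1 := key k hnk hk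
  have hun := pow_nonneg hu0 n
  have huk := pow_nonneg hu0 k
  have h2 : |(∑ j ∈ Finset.range (k + 1), x j) * u ^ k| ≤ B * u ^ k := by
    rw [abs_mul, abs_of_nonneg huk]; gcongr; exact hB k hk
  have h3 : |(∑ j ∈ Finset.range (n + 1), x j) * u ^ n| ≤ B * u ^ n := by
    rw [abs_mul, abs_of_nonneg hun]; gcongr; exact hB n (by omega)
  rw [abs_le] at h1 h2 h3 ⊢
  constructor <;> linarith

/-! ### Many roots force a polynomial to be small -/

/-- **Blaschke bound.** If `p` is at most `M` on the circle of centre `c` and radius `R`, and `s` is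
a multiset of roots at pseudo-hyperbolic distance at most `q` from `w` in the disc, then
`|p(w)| ≤ M q ^ |s|`: dividing `p` by the Blaschke factors of `s` does not change its size on the
circle, and the maximum principle applies to the quotient. -/
lemma abs_eval_le_mul_pow_card {p : ℝ[X]} {c R M q : ℝ} (hR : 0 < R)
    (hM : ∀ z : ℂ, ‖z - c‖ = R → ‖aeval z p‖ ≤ M) {s : Multiset ℝ} (hp : p ≠ 0) (hs : s ≤ p.roots)
    {w : ℝ} (hw : |w - c| ≤ R) (hq0 : 0 ≤ q)
    (hq : ∀ a ∈ s, R * |w - a| ≤ q * |R ^ 2 - (a - c) * (w - c)|) :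
    |p.eval w| ≤ M * q ^ s.card := by
  obtain ⟨Q, hQ⟩ := (Multiset.prod_X_sub_C_dvd_iff_le_roots hp s).2 hs
  set f : ℝ → ℝ[X] := fun a => X - C a with hf
  set g : ℝ → ℝ[X] := fun a => C R - C ((a - c) / R) * (X - C c) with hg
  -- on the circle the factors `f a` and `g a` have the same size
  have hcirc : ∀ z : ℂ, ‖z - c‖ = R → ∀ a, ‖aeval z (f a)‖ = ‖aeval z (g a)‖ := by
    intro z hz a
    have e1 : aeval z (f a) = z - a := by simp [hf]
    have e2 : aeval z (g a) = R - ((a - c) / R : ℝ) * (z - c) := by simp [hg]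
    rw [e1, e2]
    have hsq : ‖z - a‖ ^ 2 = ‖(R : ℂ) - ((a - c) / R : ℝ) * (z - c)‖ ^ 2 := by
      have hzz : (z.re - c) ^ 2 + z.im ^ 2 = R ^ 2 := by
        rw [← hz, Complex.sq_norm, Complex.normSq_apply]; simp; ring
      rw [Complex.sq_norm, Complex.sq_norm, Complex.normSq_apply, Complex.normSq_apply]
      simp only [Complex.sub_re, Complex.sub_im, Complex.ofReal_re, Complex.ofReal_im,
        Complex.mul_re, Complex.mul_im, sub_zero, zero_mul, add_zero, zero_sub]
      field_simp
      linear_combination ((a - c) ^ 2 - R ^ 2) * (-1) * hzz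
    exact (pow_left_inj₀ (norm_nonneg _) (norm_nonneg _) two_ne_zero).1 hsq
  have hprod : ∀ z : ℂ, ‖z - c‖ = R → ∀ t : Multiset ℝ,
      ‖aeval z (t.map f).prod‖ = ‖aeval z (t.map g).prod‖ := by
    intro z hz t
    induction t using Multiset.induction with
    | empty => simp
    | cons a t ih => simp only [Multiset.map_cons, Multiset.prod_cons, map_mul, norm_mul, ih,
        hcirc z hz a]
  have hreal : ∀ t : Multiset ℝ, (∀ a ∈ t, a ∈ s) →
      |(t.map f).prod.eval w| ≤ q ^ t.card * |(t.map g).prod.eval w| := by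
    intro t
    induction t using Multiset.induction with
    | empty => simp
    | cons a t ih =>
      intro hmem
      have h1 := ih fun b hb => hmem b (Multiset.mem_cons_of_mem hb)
      have h2 : |(f a).eval w| ≤ q * |(g a).eval w| := by
        have h := hq a (hmem a (Multiset.mem_cons_self a t))
        have e : (g a).eval w = (R ^ 2 - (a - c) * (w - c)) / R := by
          simp only [hg, eval_sub, eval_mul, eval_C, eval_X]; field_simp
        rw [e, abs_div, abs_of_pos hR, mul_div_assoc', le_div_iff₀ hR]
        simp only [hf, eval_sub, eval_X, eval_C]
        linarith
      simp only [Multiset.map_cons, Multiset.prod_cons, eval_mul, abs_mul, Multiset.card_cons,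
        pow_succ]
      calc |(f a).eval w| * |(t.map f).prod.eval w|
          ≤ (q * |(g a).eval w|) * (q ^ t.card * |(t.map g).prod.eval w|) := by gcongr
        _ = _ := by ring
  set G : ℝ[X] := (s.map g).prod * Q with hG
  have hGw : |G.eval w| ≤ M := by
    have hmax := Complex.norm_le_of_forall_mem_frontier_norm_le (f := fun z : ℂ => aeval z G)
      (U := Metric.ball (c : ℂ) R) Metric.isBounded_ball
      (Polynomial.differentiable_aeval G).diffContOnCl (C := M) ?_ (z := (w : ℂ)) ?_
    · rwa [aeval_ofReal_eq, Complex.norm_real, Real.norm_eq_abs] at hmax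
    · intro z hz
      rw [frontier_ball _ hR.ne', mem_sphere_iff_norm] at hz
      refine le_trans (le_of_eq ?_) (hM z hz)
      rw [hQ, hG, map_mul, map_mul, norm_mul, norm_mul, hprod z hz]
    · rw [closure_ball _ hR.ne', mem_closedBall_iff_norm, ← Complex.ofReal_sub, Complex.norm_real]
      exact hw
  calc |p.eval w| = |(s.map f).prod.eval w| * |Q.eval w| := by
        conv_lhs => rw [hQ]
        rw [eval_mul, abs_mul]
    _ ≤ (q ^ s.card * |(s.map g).prod.eval w|) * |Q.eval w| := by
        gcongr; exact hreal s fun a ha => ha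
    _ = q ^ s.card * |G.eval w| := by rw [hG, eval_mul, abs_mul]; ring
    _ ≤ q ^ s.card * M := by gcongr
    _ = _ := mul_comm _ _

/-! ### Counting roots -/

open Classical in
/-- The number of roots in `I` with multiplicity, as a natural number; it is `0` for the zero
polynomial, whose multiset of roots is empty by convention. -/
noncomputable def numRoots (p : ℝ[X]) (I : Set ℝ) : ℕ := (p.roots.filter (fun x => x ∈ I)).card

lemma rootCount_eq_numRoots {p : ℝ[X]} (hp : p ≠ 0) (I : Set ℝ) :
    rootCount p I = (numRoots p I : ℕ∞) := by
  rw [rootCount, if_neg hp, numRoots]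

lemma numRoots_eq_zero_iff {p : ℝ[X]} {I : Set ℝ} :
    numRoots p I = 0 ↔ ∀ a ∈ p.roots, a ∉ I := by
  classical
  rw [numRoots, Multiset.card_eq_zero, Multiset.filter_eq_nil]

lemma numRoots_X_sub_C_mul {Q : ℝ[X]} {I : Set ℝ} {a : ℝ} (ha : a ∈ I) (hQ : (X - C a) * Q ≠ 0) :
    numRoots ((X - C a) * Q) I = numRoots Q I + 1 := by
  classical
  rw [numRoots, numRoots, roots_mul hQ, roots_X_sub_C, Multiset.filter_add, Multiset.card_add,
    Multiset.filter_singleton, if_pos ha, Multiset.card_singleton, add_comm]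

lemma numRoots_union (p : ℝ[X]) {I J : Set ℝ} (h : Disjoint I J) :
    numRoots p (I ∪ J) = numRoots p I + numRoots p J := by
  classical
  unfold numRoots
  rw [← Multiset.card_add, Multiset.filter_add_filter]
  have : p.roots.filter (fun x => x ∈ I ∧ x ∈ J) = 0 := by
    rw [Multiset.filter_eq_nil]
    rintro a - ⟨h1, h2⟩
    exact Set.disjoint_left.1 h h1 h2
  rw [this, add_zero]
  congr!

lemma abs_eval_le_mul_pow_numRoots {p : ℝ[X]} (hp : p ≠ 0) {c R M q : ℝ} (hR : 0 < R)
    (hM : ∀ z : ℂ, ‖z - c‖ = R → ‖aeval z p‖ ≤ M) {I : Set ℝ}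
    {w : ℝ} (hw : |w - c| ≤ R) (hq0 : 0 ≤ q)
    (hq : ∀ a ∈ I, R * |w - a| ≤ q * |R ^ 2 - (a - c) * (w - c)|) :
    |p.eval w| ≤ M * q ^ numRoots p I := by
  classical
  refine abs_eval_le_mul_pow_card hR hM hp (Multiset.filter_le _ _) hw hq0 fun a ha => hq a ?_
  exact (Multiset.mem_filter.1 ha).2

lemma eval_mul_eval_pos_of_numRoots_eq_zero {p : ℝ[X]} {u v : ℝ} (huv : u ≤ v) (hu : p.eval u ≠ 0)
    (h : numRoots p (Set.Ioc u v) = 0) : 0 < p.eval u * p.eval v := by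
  have hp : p ≠ 0 := by rintro rfl; simp at hu
  have hno : ∀ x ∈ Set.Icc u v, p.eval x ≠ 0 := by
    intro x hx h0
    rcases eq_or_lt_of_le hx.1 with rfl | hlt
    · exact hu h0
    · exact numRoots_eq_zero_iff.1 h x ((mem_roots hp).2 h0) ⟨hlt, hx.2⟩
  by_contra hc
  push Not at hc
  have hcont : ContinuousOn (fun x => p.eval x) (Set.Icc u v) := p.continuous.continuousOn
  have h0 : (0:ℝ) ∈ (fun x => p.eval x) '' Set.Icc u v := by
    rcases le_or_gt (p.eval u) 0 with h1 | h1
    · have hv : 0 ≤ p.eval v := by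
        by_contra h2; push Not at h2
        have := lt_of_le_of_ne h1 hu
        nlinarith
      exact intermediate_value_Icc huv hcont ⟨h1, hv⟩
    · have hv : p.eval v ≤ 0 := by
        by_contra h2; push Not at h2
        nlinarith
      exact intermediate_value_Icc' huv hcont ⟨hv, h1.le⟩
  obtain ⟨x, hx, hx0⟩ := h0
  exact hno x hx hx0

lemma eval_mul_eval_neg_of_numRoots_eq_one {p : ℝ[X]} {u v : ℝ} (huv : u ≤ v)
    (hu : p.eval u ≠ 0) (hv : p.eval v ≠ 0)
    (h : numRoots p (Set.Ioc u v) = 1) : p.eval u * p.eval v < 0 := by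
  have hp : p ≠ 0 := by rintro rfl; simp at hu
  obtain ⟨a, hamem⟩ : ∃ a, a ∈ p.roots ∧ a ∈ Set.Ioc u v := by
    by_contra hc
    push Not at hc
    have := numRoots_eq_zero_iff.2 hc
    omega
  obtain ⟨Q, hQ⟩ := dvd_iff_isRoot.2 (isRoot_of_mem_roots hamem.1)
  have hQ0 : (X - C a) * Q ≠ 0 := hQ ▸ hp
  have hcQ : numRoots Q (Set.Ioc u v) = 0 := by
    rw [hQ, numRoots_X_sub_C_mul hamem.2 hQ0] at h
    omega
  have heu : p.eval u = (u - a) * Q.eval u := by conv_lhs => rw [hQ]; simp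
  have hev : p.eval v = (v - a) * Q.eval v := by conv_lhs => rw [hQ]; simp
  have hQu : Q.eval u ≠ 0 := fun h => hu (by rw [heu, h, mul_zero])
  have hpos := eval_mul_eval_pos_of_numRoots_eq_zero huv hQu hcQ
  have hva : v - a ≠ 0 := fun h => hv (by rw [hev, h, zero_mul])
  have hva' : 0 < v - a := lt_of_le_of_ne (by linarith [hamem.2.2]) hva.symm
  have hua : u - a < 0 := by linarith [hamem.2.1]
  rw [heu, hev]
  nlinarith [mul_pos (mul_pos hva' (neg_pos.2 hua)) hpos]

/-- Two polynomials with the same signs at both ends of a cell, each with at most one root in it,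
have the same number of roots in it. -/
lemma numRoots_eq_of_sign_eq {p r : ℝ[X]} {u v : ℝ} (huv : u ≤ v)
    (hu : 0 < p.eval u * r.eval u) (hv : 0 < p.eval v * r.eval v)
    (hp : numRoots p (Set.Ioc u v) ≤ 1) (hr : numRoots r (Set.Ioc u v) ≤ 1) :
    numRoots p (Set.Ioc u v) = numRoots r (Set.Ioc u v) := by
  have hpu : p.eval u ≠ 0 := left_ne_zero_of_mul hu.ne'
  have hru : r.eval u ≠ 0 := right_ne_zero_of_mul hu.ne'
  have hpv : p.eval v ≠ 0 := left_ne_zero_of_mul hv.ne'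
  have hrv : r.eval v ≠ 0 := right_ne_zero_of_mul hv.ne'
  have hprod : 0 < (p.eval u * p.eval v) * (r.eval u * r.eval v) := by
    have := mul_pos hu hv; linarith
  have hp2 : numRoots p (Set.Ioc u v) = 0 ∨ numRoots p (Set.Ioc u v) = 1 := by omega
  have hr2 : numRoots r (Set.Ioc u v) = 0 ∨ numRoots r (Set.Ioc u v) = 1 := by omega
  rcases hp2 with h1 | h1 <;> rcases hr2 with h2 | h2
  · omega
  · have a1 := eval_mul_eval_pos_of_numRoots_eq_zero huv hpu h1
    have a2 := eval_mul_eval_neg_of_numRoots_eq_one huv hru hrv h2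
    nlinarith
  · have a1 := eval_mul_eval_neg_of_numRoots_eq_one huv hpu hpv h1
    have a2 := eval_mul_eval_pos_of_numRoots_eq_zero huv hru h2
    nlinarith
  · omega

lemma numRoots_Ioc_eq_of_forall_cell {p r : ℝ[X]} {t : ℕ → ℝ} (ht : Monotone t) (N : ℕ)
    (h : ∀ i < N, numRoots p (Set.Ioc (t i) (t (i + 1))) = numRoots r (Set.Ioc (t i) (t (i + 1)))) :
    numRoots p (Set.Ioc (t 0) (t N)) = numRoots r (Set.Ioc (t 0) (t N)) := by
  induction N with
  | zero => simp [numRoots]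
  | succ N ih =>
    have e := Set.Ioc_union_Ioc_eq_Ioc (ht (Nat.zero_le N)) (ht (Nat.le_succ N))
    have hd : Disjoint (Set.Ioc (t 0) (t N)) (Set.Ioc (t N) (t (N + 1))) :=
      Set.disjoint_left.2 fun x hx hx' => absurd hx.2 (not_le.2 hx'.1)
    rw [← e, numRoots_union _ hd, numRoots_union _ hd, ih fun i hi => h i (by omega),
      h N (Nat.lt_succ_self N)]

/-! ### Equality of root counts on a window at distance `h` from `1` -/

/-- A lower bound for `|p_n(u)|` passes on to all the `p_k`, which have the same sign at `u`. -/
lemma lower_bound_eval_coeffPoly {x : ℕ → ℝ} {K : ℕ} {B : ℝ}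
    (hB : ∀ m ≤ K, |∑ j ∈ Finset.range (m + 1), x j| ≤ B) {n k : ℕ} (hnk : n ≤ k) (hk : k ≤ K)
    {u m : ℝ} (hu0 : 0 ≤ u) (hu1 : u ≤ 1) (hm : 0 < m) (hBu : 2 * B * u ^ n ≤ m)
    (hlow : 2 * m ≤ |(coeffPoly x n).eval u|) :
    m ≤ |(coeffPoly x k).eval u| ∧ 0 < (coeffPoly x k).eval u * (coeffPoly x n).eval u := by
  have h := (abs_eval_coeffPoly_sub_le hB hnk hk hu0 hu1).trans hBu
  rw [abs_le] at h
  rcases le_abs'.1 hlow with h1 | h1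
  · have hk1 : (coeffPoly x k).eval u ≤ -m := by linarith
    exact ⟨le_abs'.2 (Or.inl hk1), mul_pos_of_neg_of_neg (by linarith) (by linarith)⟩
  · have hk1 : m ≤ (coeffPoly x k).eval u := by linarith
    exact ⟨le_abs'.2 (Or.inr hk1), mul_pos (by linarith) (by linarith)⟩

/-- The `i`-th of the points that divide the window `[exp (-11 h / 10), exp (-h)]` into `N` equal
cells. -/
noncomputable def gridPoint (h : ℝ) (N i : ℕ) : ℝ :=
  Real.exp (-(11 / 10 * h)) + i * ((Real.exp (-h) - Real.exp (-(11 / 10 * h))) / N)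

lemma gridPoint_mem {h : ℝ} (hh : 0 < h) {N i : ℕ} (hN : 1 ≤ N) (hi : i ≤ N) :
    Real.exp (-(11 / 10 * h)) ≤ gridPoint h N i ∧ gridPoint h N i ≤ Real.exp (-h) := by
  have hd : 0 ≤ Real.exp (-h) - Real.exp (-(11 / 10 * h)) := by
    rw [sub_nonneg]; exact Real.exp_le_exp.2 (by linarith)
  have hN0 : (0:ℝ) < N := by exact_mod_cast hN
  have hiN : (i : ℝ) ≤ N := by exact_mod_cast hi
  constructor
  · unfold gridPoint
    have : 0 ≤ (i : ℝ) * ((Real.exp (-h) - Real.exp (-(11 / 10 * h))) / N) := by positivity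
    linarith
  · unfold gridPoint
    have : (i : ℝ) * ((Real.exp (-h) - Real.exp (-(11 / 10 * h))) / N)
        ≤ N * ((Real.exp (-h) - Real.exp (-(11 / 10 * h))) / N) := by gcongr
    rw [mul_div_cancel₀ _ hN0.ne'] at this
    linarith

lemma numRoots_window_eq {x : ℕ → ℝ} {K : ℕ} {B : ℝ} (hB0 : 0 < B)
    (hB : ∀ m ≤ K, |∑ j ∈ Finset.range (m + 1), x j| ≤ B) {n k : ℕ} (hnk : n ≤ k) (hk : k ≤ K)
    {h m : ℝ} (hh : 0 < h) {N : ℕ} (hN : 1 ≤ N) (hm : 0 < m)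
    (hlow : ∀ i ≤ N, 2 * m ≤ |(coeffPoly x n).eval (gridPoint h N i)|)
    (h1 : 2 * B * Real.exp (-h) ^ n ≤ m) (h2 : 4 * B * (1 / (5 * N)) ^ 2 < m) :
    numRoots (coeffPoly x k) (Set.Ioc (Real.exp (-(11 / 10 * h))) (Real.exp (-h)))
      = numRoots (coeffPoly x n) (Set.Ioc (Real.exp (-(11 / 10 * h))) (Real.exp (-h))) := by
  set v := Real.exp (-h) with hv
  set v' := Real.exp (-(11 / 10 * h)) with hv'
  have hN0 : (0:ℝ) < N := by exact_mod_cast hN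
  have hv0 : 0 < v := Real.exp_pos _
  have hv'0 : 0 < v' := Real.exp_pos _
  have hv1 : v < 1 := by rw [hv, Real.exp_lt_one_iff]; linarith
  have hvv' : v' < v := Real.exp_lt_exp.2 (by linarith)
  set s := (v - v') / N with hs
  have hs0 : 0 < s := by rw [hs]; exact div_pos (by linarith) hN0
  -- the cell length is at most `1 / (5 N)` times the radius `(1 - v) / 2`
  set R := (1 - v) / 2 with hR
  have hR0 : 0 < R := by rw [hR]; linarith
  have hsR : s / R ≤ 1 / (5 * N) := by
    have e1 : v - v' ≤ h / 10 * v := by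
      have : v' = v * Real.exp (-(h / 10)) := by rw [hv, hv', ← Real.exp_add]; congr 1; ring
      have h3 := Real.one_sub_le_exp_neg (h / 10)
      rw [this]; nlinarith
    have e2 : h * v ≤ 1 - v := by
      have h3 := Real.add_one_le_exp h
      have h4 : v * Real.exp h = 1 := by rw [hv, ← Real.exp_add]; simp
      nlinarith
    have e3 : v - v' ≤ 1 / 5 * R := by rw [hR]; linarith
    rw [hs, div_div, div_le_div_iff₀ (by positivity) (by positivity)]
    nlinarith
  have hq1 : s / R ≤ 1 := by
    refine hsR.trans ?_
    rw [div_le_one (by positivity)]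
    have : (1:ℝ) ≤ N := by exact_mod_cast hN
    linarith
  have hsucc : ∀ i, gridPoint h N (i + 1) = gridPoint h N i + s := by
    intro i; simp only [gridPoint, ← hv, ← hv', ← hs]; push_cast; ring
  have hmono : Monotone (gridPoint h N) := monotone_nat_of_le_succ fun i => by
    rw [hsucc]; linarith
  have hgood : ∀ k, n ≤ k → k ≤ K → ∀ i ≤ N, m ≤ |(coeffPoly x k).eval (gridPoint h N i)| ∧
      0 < (coeffPoly x k).eval (gridPoint h N i) * (coeffPoly x n).eval (gridPoint h N i) := by
    intro k hnk hk i hi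
    obtain ⟨ha, hb⟩ := gridPoint_mem hh hN hi
    have hpos : 0 ≤ gridPoint h N i := hv'0.le.trans ha
    refine lower_bound_eval_coeffPoly hB hnk hk hpos (hb.trans hv1.le) hm ?_ (hlow i hi)
    refine le_trans ?_ h1
    gcongr
  -- two roots in a cell would make the polynomial too small at its left end
  have hone : ∀ k, n ≤ k → k ≤ K → ∀ i < N,
      numRoots (coeffPoly x k) (Set.Ioc (gridPoint h N i) (gridPoint h N (i + 1))) ≤ 1 := by
    intro k hnk hk i hi
    by_contra hc
    push Not at hc
    obtain ⟨hm1, hm2⟩ := hgood k hnk hk i hi.le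
    obtain ⟨ha, hb⟩ := gridPoint_mem hh hN hi.le
    rw [← hv'] at ha
    rw [← hv] at hb
    set u := gridPoint h N i with hu
    have hp : coeffPoly x k ≠ 0 := by
      intro h0; rw [h0] at hm2; simp at hm2
    have hM : ∀ z : ℂ, ‖z - u‖ = R → ‖aeval z (coeffPoly x k)‖ ≤ 4 * B := by
      intro z hz
      have hz1 : ‖z‖ ≤ u + R := by
        have := norm_le_norm_add_norm_sub' z (u : ℂ)
        rw [Complex.norm_real, Real.norm_eq_abs, abs_of_nonneg (hv'0.le.trans ha)] at this
        linarith
      have hz2 : ‖1 - z‖ ≤ (1 - u) + R := by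
        have := norm_sub_le_norm_sub_add_norm_sub (1 : ℂ) u z
        rw [norm_sub_rev (u : ℂ) z, hz, ← Complex.ofReal_one, ← Complex.ofReal_sub,
          Complex.norm_real, Real.norm_eq_abs, abs_of_nonneg (by linarith)] at this
        exact_mod_cast this
      have hlt : ‖z‖ < 1 := by rw [hR] at hz1; linarith
      refine (norm_aeval_coeffPoly_le_of_norm_lt_one hB0.le hB hk hlt).trans ?_
      have : ‖1 - z‖ / (1 - ‖z‖) ≤ 3 := by
        rw [div_le_iff₀ (by linarith)]
        rw [hR] at hz1 hz2
        linarith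
      nlinarith
    have hle := abs_eval_le_mul_pow_numRoots hp (c := u) (w := u) (q := s / R) hR0 hM
      (I := Set.Ioc u (gridPoint h N (i + 1))) (by simpa using hR0.le) (by positivity) (by
        rintro a ⟨ha1, ha2⟩
        rw [hsucc] at ha2
        rw [sub_self, mul_zero, sub_zero, abs_of_pos (by positivity : 0 < R ^ 2), abs_sub_comm,
          abs_of_pos (by linarith)]
        have e : s / R * R ^ 2 = R * s := by field_simp
        rw [e]
        gcongr
        linarith)
    have hpow : (s / R) ^ numRoots (coeffPoly x k) (Set.Ioc u (gridPoint h N (i + 1)))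
        ≤ (1 / (5 * N)) ^ 2 := by
      refine (pow_le_pow_of_le_one (by positivity) hq1 hc).trans ?_
      gcongr
    have : 4 * B * (s / R) ^ numRoots (coeffPoly x k) (Set.Ioc u (gridPoint h N (i + 1)))
        ≤ 4 * B * (1 / (5 * N)) ^ 2 := by gcongr
    linarith
  have hcells := numRoots_Ioc_eq_of_forall_cell (p := coeffPoly x k) (r := coeffPoly x n) hmono N
    fun i hi => numRoots_eq_of_sign_eq (hmono (Nat.le_succ i)) (hgood k hnk hk i hi.le).2
      (hgood k hnk hk (i + 1) hi).2 (hone k hnk hk i hi) (hone n le_rfl (hnk.trans hk) i hi)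
  have e0 : gridPoint h N 0 = v' := by simp [gridPoint, hv']
  have eN : gridPoint h N N = v := by
    simp only [gridPoint, ← hv, ← hv']; field_simp; ring
  rwa [e0, eN] at hcells

/-- The lower bound for `p_n(u)` that fails with probability of order `u ^ (3 n / 10)`. -/
noncomputable def level (n : ℕ) (u : ℝ) : ℝ := (√(1 - u))⁻¹ * u ^ ((n : ℝ) / 2)

lemma level_pos {n : ℕ} {u : ℝ} (hu0 : 0 < u) (hu1 : u < 1) : 0 < level n u := by
  have : 0 < √(1 - u) := Real.sqrt_pos.2 (by linarith)
  unfold level; positivity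

lemma level_mono {n : ℕ} {u v : ℝ} (hu0 : 0 < u) (huv : u ≤ v) (hv1 : v < 1) :
    level n u ≤ level n v := by
  have : 0 < √(1 - v) := Real.sqrt_pos.2 (by linarith)
  unfold level
  gcongr

/-- `level n (exp (-h)) ≥ h ^ (-1/2) exp (-n h / 2)`. -/
lemma le_level_exp {n : ℕ} {h : ℝ} (hh : 0 < h) :
    (√h)⁻¹ * Real.exp (-(n * h / 2)) ≤ level n (Real.exp (-h)) := by
  have h1 : Real.exp (-h) < 1 := by rw [Real.exp_lt_one_iff]; linarith
  have h2 : 0 < √(1 - Real.exp (-h)) := Real.sqrt_pos.2 (by linarith)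
  have h3 := Real.one_sub_le_exp_neg h
  unfold level
  rw [← Real.exp_mul]
  gcongr
  · linarith
  · apply le_of_eq; ring

lemma sqrt_mul_exp_le {y D : ℝ} (hy : 1250 ≤ y) (hD : D ≤ Real.exp (y / 100)) :
    D * √y ≤ Real.exp (3 / 100 * y) := by
  have h1 : √y ≤ Real.exp (2 / 100 * y) := by
    rw [Real.sqrt_le_left (Real.exp_pos _).le, ← Real.exp_nat_mul]
    have := Real.quadratic_le_exp_of_nonneg (x := ((2 : ℕ) : ℝ) * (2 / 100 * y)) (by
      push_cast; linarith)
    push_cast at this ⊢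
    nlinarith
  calc D * √y ≤ Real.exp (y / 100) * Real.exp (2 / 100 * y) := by gcongr
    _ = _ := by rw [← Real.exp_add]; congr 1; ring

/-- On the window `[exp (-11 h / 10), exp (-h)]`, with `y = n h` large, the root counts of all the
`p_k` agree outside an event of probability of order `exp (-y / 100)`, as long as the partial sums of
the coefficients are at most `B`. With about
`exp (29 y / 100)` cells, the union bound over the end points of the small-ball probabilities
`exp (-30 y / 100)` still succeeds, and the cells are short enough to hold at most one root. -/
lemma measureReal_window_le {Ω : Type*} [MeasurableSpace Ω] {μ : Measure Ω} [IsProbabilityMeasure μ]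
    {ξ : ℕ → Ω → ℝ} {C κ : ℝ} (hC : 0 < C) {n K : ℕ}
    (hsb : ∀ u : ℝ, 1 - κ ≤ u → u < 1 →
      μ.real {ω | |(coeffPoly (fun j => ξ j ω) n).eval u| ≤ level n u}
        ≤ C * u ^ (3 / 10 * (n : ℝ)))
    {B D h : ℝ} (hD : 0 < D) (hB : B = D * √n) (hn : 1 ≤ n) (hh : 0 < h)
    (hκ : 1 - κ ≤ Real.exp (-(11 / 10 * h)))
    (hy : 1250 ≤ n * h) (hDy : D ≤ Real.exp (n * h / 100)) :
    μ.real {ω | (∀ m ≤ K, |∑ j ∈ Finset.range (m + 1), ξ j ω| ≤ B) ∧ ∃ k, n ≤ k ∧ k ≤ K ∧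
      numRoots (coeffPoly (fun j => ξ j ω) k)
        (Set.Ioc (Real.exp (-(11 / 10 * h))) (Real.exp (-h)))
      ≠ numRoots (coeffPoly (fun j => ξ j ω) n)
        (Set.Ioc (Real.exp (-(11 / 10 * h))) (Real.exp (-h)))}
      ≤ 3 * C * Real.exp (-(n * h / 100)) := by
  set y := n * h with hydef
  have hn0 : (0:ℝ) < n := by exact_mod_cast hn
  have hy0 : 0 < y := by positivity
  set v := Real.exp (-h) with hv
  set v' := Real.exp (-(11 / 10 * h)) with hv'
  have hv1 : v < 1 := by rw [hv, Real.exp_lt_one_iff]; linarith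
  have hvv' : v' < v := Real.exp_lt_exp.2 (by linarith)
  have hv'0 : 0 < v' := Real.exp_pos _
  set N := ⌈Real.exp (29 / 100 * y)⌉₊ with hN
  have hNlow : Real.exp (29 / 100 * y) ≤ N := Nat.le_ceil _
  have hN1 : (1:ℝ) ≤ Real.exp (29 / 100 * y) := Real.one_le_exp (by positivity)
  have hNup : (N : ℝ) + 1 ≤ 3 * Real.exp (29 / 100 * y) := by
    have := Nat.ceil_lt_add_one (Real.exp_pos (29 / 100 * y)).le
    rw [← hN] at this; linarith
  have hN1' : 1 ≤ N := by
    have : (1:ℝ) ≤ N := by linarith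
    exact_mod_cast this
  have hB0 : 0 < B := by rw [hB]; positivity
  set m := level n v' / 2 with hm
  have hm0 : 0 < m := by rw [hm]; have := level_pos (n := n) hv'0 (hvv'.trans hv1); linarith
  -- `B √h = D √y`, so the level dominates `B` times the relevant exponentials
  have hX := sqrt_mul_exp_le hy hDy
  have hBh : B * √h = D * √y := by
    rw [hB, hydef, Real.sqrt_mul hn0.le]; ring
  have hsqh : 0 < √h := Real.sqrt_pos.2 hh
  have hmlow : Real.exp (-(55 / 100 * y)) ≤ 22 / 10 * √h * m := by
    have h1 := le_level_exp (n := n) (h := 11 / 10 * h) (by positivity)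
    rw [← hv'] at h1
    have h2 : √(11 / 10 * h) ≤ 11 / 10 * √h := by
      rw [Real.sqrt_mul (by norm_num)]
      gcongr
      rw [Real.sqrt_le_left (by norm_num)]; norm_num
    have h3 : 0 < √(11 / 10 * h) := Real.sqrt_pos.2 (by positivity)
    rw [inv_mul_le_iff₀ h3] at h1
    have e : -((n : ℝ) * (11 / 10 * h) / 2) = -(55 / 100 * y) := by rw [hydef]; ring
    rw [e] at h1
    have h4 : √(11 / 10 * h) * level n v' ≤ 11 / 10 * √h * level n v' := by
      have := (level_pos (n := n) hv'0 (hvv'.trans hv1)).le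
      gcongr
    rw [hm]; linarith
  have hc1 : 2 * B * v ^ n ≤ m := by
    have e : v ^ n = Real.exp (-y) := by rw [hv, ← Real.exp_nat_mul, hydef]; congr 1; ring
    rw [e]
    have h1 : 22 / 10 * √h * (2 * B * Real.exp (-y)) ≤ 22 / 10 * √h * m := by
      refine le_trans ?_ hmlow
      have e2 : 22 / 10 * √h * (2 * B * Real.exp (-y)) = 44 / 10 * (B * √h) * Real.exp (-y) := by
        ring
      rw [e2, hBh]
      have h5 : (44 / 10 : ℝ) ≤ Real.exp (42 / 100 * y) := by
        have := Real.add_one_le_exp (42 / 100 * y); linarith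
      calc 44 / 10 * (D * √y) * Real.exp (-y)
          ≤ Real.exp (42 / 100 * y) * Real.exp (3 / 100 * y) * Real.exp (-y) := by gcongr
        _ = Real.exp (-(55 / 100 * y)) := by rw [← Real.exp_add, ← Real.exp_add]; congr 1; ring
    exact le_of_mul_le_mul_left h1 (by positivity)
  have hc2 : 4 * B * (1 / (5 * N)) ^ 2 < m := by
    have h1 : 22 / 10 * √h * (4 * B * (1 / (5 * N)) ^ 2) < 22 / 10 * √h * m := by
      refine lt_of_lt_of_le ?_ hmlow
      have e2 : 22 / 10 * √h * (4 * B * (1 / (5 * N)) ^ 2)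
          = 352 / 1000 * (B * √h) * (1 / N) ^ 2 := by
        field_simp; norm_num
      rw [e2, hBh]
      have h6 : (1 / (N : ℝ)) ≤ Real.exp (-(29 / 100 * y)) := by
        rw [Real.exp_neg, ← one_div]
        gcongr
      calc 352 / 1000 * (D * √y) * (1 / (N : ℝ)) ^ 2
          ≤ 352 / 1000 * Real.exp (3 / 100 * y) * Real.exp (-(29 / 100 * y)) ^ 2 := by gcongr
        _ < 1 * Real.exp (3 / 100 * y) * Real.exp (-(29 / 100 * y)) ^ 2 := by
          gcongr; norm_num
        _ = Real.exp (-(55 / 100 * y)) := by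
          rw [← Real.exp_nat_mul, one_mul, ← Real.exp_add]; congr 1; push_cast; ring
    exact lt_of_mul_lt_mul_left h1 (by positivity)
  have hsub : {ω | (∀ m ≤ K, |∑ j ∈ Finset.range (m + 1), ξ j ω| ≤ B) ∧ ∃ k, n ≤ k ∧ k ≤ K ∧
      numRoots (coeffPoly (fun j => ξ j ω) k) (Set.Ioc v' v)
      ≠ numRoots (coeffPoly (fun j => ξ j ω) n) (Set.Ioc v' v)} ⊆
      ⋃ i ∈ Finset.range (N + 1), {ω | |(coeffPoly (fun j => ξ j ω) n).eval (gridPoint h N i)|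
        ≤ level n (gridPoint h N i)} := by
    rintro ω ⟨hS, k, hnk, hk, hne⟩
    by_contra hc
    simp only [Set.mem_iUnion, not_exists, Set.mem_ofPred_eq, not_le, Finset.mem_range] at hc
    refine hne (numRoots_window_eq hB0 hS hnk hk hh hN1' hm0 (fun i hi => ?_) hc1 hc2)
    have h1 := hc i (by omega)
    obtain ⟨ha, hb⟩ := gridPoint_mem hh hN1' hi
    have h2 := level_mono (n := n) hv'0 ha (hb.trans_lt hv1)
    rw [hm]; linarith
  refine (measureReal_mono hsub (measure_ne_top _ _)).trans
    ((measureReal_biUnion_finset_le _ _).trans ?_)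
  have hterm : ∀ i ∈ Finset.range (N + 1),
      μ.real {ω | |(coeffPoly (fun j => ξ j ω) n).eval (gridPoint h N i)|
        ≤ level n (gridPoint h N i)} ≤ C * Real.exp (-(30 / 100 * y)) := by
    intro i hi
    have hi' : i ≤ N := by have := Finset.mem_range.1 hi; omega
    obtain ⟨ha, hb⟩ := gridPoint_mem hh hN1' hi'
    refine (hsb _ (hκ.trans ha) (hb.trans_lt hv1)).trans ?_
    gcongr
    calc (gridPoint h N i) ^ (3 / 10 * (n : ℝ)) ≤ v ^ (3 / 10 * (n : ℝ)) := by
          apply Real.rpow_le_rpow (hv'0.le.trans ha) hb (by positivity)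
      _ = Real.exp (-(30 / 100 * y)) := by rw [hv, ← Real.exp_mul, hydef]; congr 1; ring
  refine (Finset.sum_le_sum hterm).trans ?_
  rw [Finset.sum_const, Finset.card_range, nsmul_eq_mul]
  push_cast
  calc ((N : ℝ) + 1) * (C * Real.exp (-(30 / 100 * y)))
      ≤ 3 * Real.exp (29 / 100 * y) * (C * Real.exp (-(30 / 100 * y))) := by gcongr
    _ = 3 * C * (Real.exp (29 / 100 * y) * Real.exp (-(30 / 100 * y))) := by ring
    _ = 3 * C * Real.exp (-(y / 100)) := by rw [← Real.exp_add]; congr 2; ring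

/-! ### Few roots next to `1` -/

lemma eval_le_mul_pow_numRoots_near_one {x : ℕ → ℝ} {K : ℕ} {B : ℝ} (hB0 : 0 < B)
    (hB : ∀ m ≤ K, |∑ j ∈ Finset.range (m + 1), x j| ≤ B) {k : ℕ} (hk : k ≤ K)
    {u : ℝ} (hu1 : u < 1) (hp : coeffPoly x k ≠ 0) :
    |(coeffPoly x k).eval u| ≤
      B * Real.exp (4 * (1 - u) * K) * (2 / 3) ^ numRoots (coeffPoly x k) (Set.Ioc u 1) := by
  have hd : 0 < 1 - u := by linarith
  refine abs_eval_le_mul_pow_numRoots hp (c := 1) (R := 2 * (1 - u)) (by positivity) ?_ ?_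
    (by norm_num) ?_
  · intro z hz
    have := norm_aeval_coeffPoly_le_exp hB0.le hB hk (z := z) (d := 2 * (1 - u))
      (by simpa using hz.le)
    refine this.trans (le_of_eq ?_)
    congr 2; ring
  · rw [abs_sub_comm, abs_of_pos hd]; linarith
  · rintro a ⟨ha1, ha2⟩
    rw [abs_sub_comm, abs_of_pos (by linarith : 0 < a - u)]
    have h1 : 3 * (1 - u) ^ 2 ≤ (2 * (1 - u)) ^ 2 - (a - 1) * (u - 1) := by nlinarith
    have h2 := le_abs_self ((2 * (1 - u)) ^ 2 - (a - 1) * (u - 1))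
    nlinarith

/-- At `u = exp (-h)`, where `y = n h` is large, `p_n(u)`, hence every `p_k(u)`, has essentially its
natural size, and therefore the `p_k` have `O(y)` roots in `(u, 1]`. -/
lemma measureReal_near_one_le {Ω : Type*} [MeasurableSpace Ω] {μ : Measure Ω}
    [IsProbabilityMeasure μ] {ξ : ℕ → Ω → ℝ} {C κ c : ℝ} {n K : ℕ} (hc : 1 < c)
    (hsb : ∀ u : ℝ, 1 - κ ≤ u → u < 1 →
      μ.real {ω | |(coeffPoly (fun j => ξ j ω) n).eval u| ≤ level n u}
        ≤ C * u ^ (3 / 10 * (n : ℝ)))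
    {B D h : ℝ} (hD : 0 < D) (hB : B = D * √n) (hn : 1 ≤ n) (hK : (K : ℝ) ≤ c * n) (hh : 0 < h)
    (hκ : 1 - κ ≤ Real.exp (-h)) (hy : 1250 ≤ n * h) (hDy : D ≤ Real.exp (n * h / 100)) :
    μ.real {ω | (∀ m ≤ K, |∑ j ∈ Finset.range (m + 1), ξ j ω| ≤ B) ∧ ∃ k, n ≤ k ∧ k ≤ K ∧
      ¬ (coeffPoly (fun j => ξ j ω) k ≠ 0 ∧
        (numRoots (coeffPoly (fun j => ξ j ω) k) (Set.Ioc (Real.exp (-h)) 1) : ℝ)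
          ≤ 15 * c * (n * h))} ≤ C * Real.exp (-(3 / 10 * (n * h))) := by
  set y := n * h with hydef
  have hn0 : (0:ℝ) < n := by exact_mod_cast hn
  have hy0 : 0 < y := by positivity
  set u := Real.exp (-h) with hu
  have hu0 : 0 < u := Real.exp_pos _
  have hu1 : u < 1 := by rw [hu, Real.exp_lt_one_iff]; linarith
  have hB0 : 0 < B := by rw [hB]; positivity
  have hsqh : 0 < √h := Real.sqrt_pos.2 hh
  have hX := sqrt_mul_exp_le hy hDy
  have hBh : B * √h = D * √y := by
    rw [hB, hydef, Real.sqrt_mul hn0.le]; ring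
  set m := level n u / 2 with hm
  have hm0 : 0 < m := by rw [hm]; have := level_pos (n := n) hu0 hu1; linarith
  have hmlow : Real.exp (-(y / 2)) ≤ 2 * √h * m := by
    have h1 := le_level_exp (n := n) hh
    rw [inv_mul_le_iff₀ hsqh, ← hu] at h1
    rw [hm]; linarith
  have hbig : (4 : ℝ) ≤ Real.exp (47 / 100 * y) := by
    have := Real.add_one_le_exp (47 / 100 * y); linarith
  have hc1 : 2 * B * u ^ n ≤ m := by
    have e : u ^ n = Real.exp (-y) := by rw [hu, ← Real.exp_nat_mul, hydef]; congr 1; ring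
    rw [e]
    have h1 : 2 * √h * (2 * B * Real.exp (-y)) ≤ 2 * √h * m := by
      refine le_trans ?_ hmlow
      calc 2 * √h * (2 * B * Real.exp (-y)) = 4 * (D * √y) * Real.exp (-y) := by rw [← hBh]; ring
        _ ≤ Real.exp (47 / 100 * y) * Real.exp (3 / 100 * y) * Real.exp (-y) := by gcongr
        _ = Real.exp (-(y / 2)) := by rw [← Real.exp_add, ← Real.exp_add]; congr 1; ring
    exact le_of_mul_le_mul_left h1 (by positivity)
  have hsub : {ω | (∀ m ≤ K, |∑ j ∈ Finset.range (m + 1), ξ j ω| ≤ B) ∧ ∃ k, n ≤ k ∧ k ≤ K ∧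
      ¬ (coeffPoly (fun j => ξ j ω) k ≠ 0 ∧
        (numRoots (coeffPoly (fun j => ξ j ω) k) (Set.Ioc u 1) : ℝ) ≤ 15 * c * y)} ⊆
      {ω | |(coeffPoly (fun j => ξ j ω) n).eval u| ≤ level n u} := by
    rintro ω ⟨hS, k, hnk, hk, hne⟩
    by_contra hcon
    simp only [Set.mem_ofPred_eq, not_le] at hcon
    obtain ⟨hm1, hm2⟩ := lower_bound_eval_coeffPoly hS hnk hk hu0.le hu1.le hm0 hc1
      (by rw [hm]; linarith)
    have hp : coeffPoly (fun j => ξ j ω) k ≠ 0 := by intro h0; rw [h0] at hm2; simp at hm2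
    refine hne ⟨hp, ?_⟩
    set N := numRoots (coeffPoly (fun j => ξ j ω) k) (Set.Ioc u 1) with hN
    have h1 := eval_le_mul_pow_numRoots_near_one hB0 hS hk hu1 hp
    rw [← hN] at h1
    have hexp : Real.exp (4 * (1 - u) * K) ≤ Real.exp (4 * c * y) := by
      apply Real.exp_le_exp.2
      have h3 := Real.one_sub_le_exp_neg h
      rw [← hu] at h3
      calc 4 * (1 - u) * K ≤ 4 * h * (c * n) := by gcongr; linarith
        _ = 4 * c * y := by rw [hydef]; ring
    have hlog : (N : ℝ) * (1 / 3) ≤ (4 * c + 1) * y := by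
      have h23 : (2 / 3 : ℝ) ≤ Real.exp (-(1 / 3)) := by
        have := Real.one_sub_le_exp_neg (1 / 3); linarith
      have h4 : Real.exp (-(y / 2)) ≤ Real.exp (y / 2 + 4 * c * y - N * (1 / 3)) := by
        calc Real.exp (-(y / 2)) ≤ 2 * √h * m := hmlow
          _ ≤ 2 * √h * (B * Real.exp (4 * c * y) * Real.exp (-(1 / 3)) ^ N) := by
            gcongr
            refine (hm1.trans h1).trans ?_
            gcongr
          _ = 2 * (D * √y) * Real.exp (4 * c * y) * Real.exp (-(1 / 3)) ^ N := by
            rw [← hBh]; ring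
          _ ≤ Real.exp (47 / 100 * y) * Real.exp (3 / 100 * y) * Real.exp (4 * c * y)
              * Real.exp (-(1 / 3)) ^ N := by gcongr; linarith
          _ = _ := by
            rw [← Real.exp_nat_mul, ← Real.exp_add, ← Real.exp_add, ← Real.exp_add]
            congr 1; ring
      have := Real.exp_le_exp.1 h4
      linarith
    nlinarith
  refine (measureReal_mono hsub).trans ((hsb u hκ hu1).trans (le_of_eq ?_))
  rw [hu, ← Real.exp_mul, hydef]; congr 2; ring

/-! ### Few roots away from `1` -/

lemma eval_le_mul_pow_numRoots_inner {x : ℕ → ℝ} {K k : ℕ} (hk : k ≤ K) {b : ℝ} (hb0 : 0 < b)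
    (hb1 : b < 1) {A : ℝ} (hA : ∑ j ∈ Finset.range (K + 1), |x j| * ((1 + b) / 2) ^ j ≤ A)
    (hp : coeffPoly x k ≠ 0) :
    |(coeffPoly x k).eval b| ≤
      A * (b / ((1 + b) / 2)) ^ numRoots (coeffPoly x k) (Set.Icc 0 b) := by
  set R := (1 + b) / 2 with hR
  have hR0 : 0 < R := by rw [hR]; linarith
  have hbR : b < R := by rw [hR]; linarith
  refine abs_eval_le_mul_pow_numRoots hp (c := 0) (R := R) hR0 ?_ ?_ (by positivity) ?_
  · intro z hz
    rw [Complex.ofReal_zero, sub_zero] at hz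
    refine le_trans ?_ hA
    rw [aeval_coeffPoly]
    refine (norm_sum_le _ _).trans ?_
    calc ∑ j ∈ Finset.range (k + 1), ‖(x j : ℂ) * z ^ j‖
        = ∑ j ∈ Finset.range (k + 1), |x j| * R ^ j := by
          refine Finset.sum_congr rfl fun j _ => ?_
          rw [norm_mul, norm_pow, hz, Complex.norm_real, Real.norm_eq_abs]
      _ ≤ _ := Finset.sum_le_sum_of_subset_of_nonneg
          (Finset.range_mono (by omega)) fun j _ _ => by positivity
  · rw [sub_zero, abs_of_pos hb0]; exact hbR.le
  · rintro a ⟨ha0, hab⟩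
    rw [sub_zero, sub_zero, abs_of_nonneg (by linarith : 0 ≤ b - a)]
    refine le_trans ?_ (mul_le_mul_of_nonneg_left (le_abs_self _) (by positivity))
    rw [show b / R * (R ^ 2 - a * b) = b * (R ^ 2 - a * b) / R by ring, le_div_iff₀ hR0]
    nlinarith [mul_nonneg ha0 (by nlinarith : 0 ≤ R ^ 2 - b ^ 2)]

/-- In `[0, b]`, `b = exp (-h)`, all the `p_k` have `O(s)` roots, unless the coefficients are large or
`|p_n(b)| ≤ exp (-s)`, which has probability of order `exp (-3 s / 5)`. For `b` fixed, `s` may be any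
small multiple of `log n`. -/
lemma measureReal_inner_le {Ω : Type*} [MeasurableSpace Ω] {μ : Measure Ω}
    [IsProbabilityMeasure μ] {ξ : ℕ → Ω → ℝ} {C : ℝ} {n K : ℕ} {h : ℝ} (hh : 0 < h)
    (hsb : ∀ m : ℝ, 0 ≤ m → m ≤ n →
      μ.real {ω | |(coeffPoly (fun j => ξ j ω) n).eval (Real.exp (-h))|
        ≤ (√(1 - Real.exp (-h)))⁻¹ * Real.exp (-h) ^ m} ≤ C * Real.exp (-h) ^ (3 / 5 * m))
    {B s lam : ℝ}
    (hq : Real.exp (-h) / ((1 + Real.exp (-h)) / 2) ≤ Real.exp (-lam))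
    (hs1 : 1 ≤ s) (hsn : s ≤ h * n) (hBs : 4 * B * Real.exp (-(h * n)) ≤ Real.exp (-s)) :
    μ.real {ω | (∀ m ≤ K, |∑ j ∈ Finset.range (m + 1), ξ j ω| ≤ B) ∧
      ∑ j ∈ Finset.range (K + 1), |ξ j ω| * ((1 + Real.exp (-h)) / 2) ^ j ≤ Real.exp s ∧
      ∃ k, n ≤ k ∧ k ≤ K ∧
      ¬ (numRoots (coeffPoly (fun j => ξ j ω) k) (Set.Icc 0 (Real.exp (-h))) : ℝ) * lam ≤ 3 * s}
      ≤ C * Real.exp (-(3 / 5 * s)) := by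
  set b := Real.exp (-h) with hb
  have hb0 : 0 < b := Real.exp_pos _
  have hb1 : b < 1 := by rw [hb, Real.exp_lt_one_iff]; linarith
  have hpow : b ^ (s / h) = Real.exp (-s) := by
    rw [hb, ← Real.exp_mul]; congr 1; field_simp
  have hsub : {ω | (∀ m ≤ K, |∑ j ∈ Finset.range (m + 1), ξ j ω| ≤ B) ∧
      ∑ j ∈ Finset.range (K + 1), |ξ j ω| * ((1 + b) / 2) ^ j ≤ Real.exp s ∧
      ∃ k, n ≤ k ∧ k ≤ K ∧
      ¬ (numRoots (coeffPoly (fun j => ξ j ω) k) (Set.Icc 0 b) : ℝ) * lam ≤ 3 * s} ⊆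
      {ω | |(coeffPoly (fun j => ξ j ω) n).eval b| ≤ (√(1 - b))⁻¹ * b ^ (s / h)} := by
    rintro ω ⟨hS, hA, k, hnk, hk, hne⟩
    by_contra hcon
    simp only [Set.mem_ofPred_eq, not_le] at hcon
    apply hne
    have hlow : Real.exp (-s) ≤ |(coeffPoly (fun j => ξ j ω) n).eval b| := by
      refine le_trans ?_ hcon.le
      rw [hpow]
      refine le_mul_of_one_le_left (Real.exp_pos _).le ?_
      have h1 : 0 < √(1 - b) := Real.sqrt_pos.2 (by linarith)
      rw [one_le_inv₀ h1]
      exact Real.sqrt_le_iff.2 ⟨zero_le_one, by linarith⟩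
    have hm0 : 0 < Real.exp (-s) / 2 := by positivity
    obtain ⟨hm1, hm2⟩ := lower_bound_eval_coeffPoly hS hnk hk hb0.le hb1.le hm0
      (by
        have e : b ^ n = Real.exp (-(h * n)) := by rw [hb, ← Real.exp_nat_mul]; congr 1; ring
        rw [e]; linarith)
      (by linarith)
    have hp : coeffPoly (fun j => ξ j ω) k ≠ 0 := by intro h0; rw [h0] at hm2; simp at hm2
    set N := numRoots (coeffPoly (fun j => ξ j ω) k) (Set.Icc 0 b) with hN
    have h1 := eval_le_mul_pow_numRoots_inner hk hb0 hb1 hA hp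
    rw [← hN] at h1
    have h2 : Real.exp (-s) ≤ Real.exp (1 + s - N * lam) := by
      have he : (2:ℝ) ≤ Real.exp 1 := by have := Real.add_one_le_exp 1; linarith
      calc Real.exp (-s) = 2 * (Real.exp (-s) / 2) := by ring
        _ ≤ Real.exp 1 * (Real.exp s * Real.exp (-lam) ^ N) := by
          gcongr
          refine (hm1.trans h1).trans ?_
          gcongr
        _ = _ := by
          rw [← Real.exp_nat_mul, ← Real.exp_add, ← Real.exp_add]; congr 1; ring
    have h3 := Real.exp_le_exp.1 h2
    linarith
  refine (measureReal_mono hsub).trans ((hsb (s / h) (by positivity) ?_).trans (le_of_eq ?_))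
  · rw [div_le_iff₀ hh]; linarith
  · rw [mul_comm (3 / 5 : ℝ), Real.rpow_mul hb0.le, hpow, ← Real.exp_mul]; congr 2; ring

/-- Markov's inequality for the coefficients weighted by a fixed geometric sequence. -/
lemma measureReal_sum_abs_mul_pow_le {Ω : Type*} [MeasurableSpace Ω] {μ : Measure Ω}
    [IsProbabilityMeasure μ] {ξ : ℕ → Ω → ℝ} (hL2 : ∀ j, MemLp (ξ j) 2 μ)
    (hsq : ∀ j, ∫ ω, ξ j ω ^ 2 ∂μ = 1) {R : ℝ} (hR0 : 0 ≤ R) (hR1 : R < 1) (K : ℕ) {A : ℝ}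
    (hA : 0 < A) :
    μ.real {ω | A ≤ ∑ j ∈ Finset.range (K + 1), |ξ j ω| * R ^ j} ≤ 1 / (1 - R) / A := by
  have hint : ∀ j, Integrable (fun ω => |ξ j ω|) μ := fun j =>
    ((hL2 j).integrable (by norm_num)).abs
  have hE : ∀ j, ∫ ω, |ξ j ω| ∂μ ≤ 1 := by
    intro j
    have h2 : Integrable (fun ω => (ξ j ω ^ 2 + 1) / 2) μ :=
      ((hL2 j).integrable_sq.add (integrable_const 1)).div_const 2
    have h1 := integral_mono (hint j) h2 (fun ω => by
      have := sq_nonneg (|ξ j ω| - 1)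
      have e := sq_abs (ξ j ω)
      simp only
      nlinarith)
    rw [integral_div, integral_add (hL2 j).integrable_sq (integrable_const 1), hsq] at h1
    simpa using h1
  have hsum : Integrable (fun ω => ∑ j ∈ Finset.range (K + 1), |ξ j ω| * R ^ j) μ :=
    integrable_finsetSum _ fun j _ => (hint j).mul_const _
  have h := mul_meas_ge_le_integral_of_nonneg (μ := μ)
    (Filter.Eventually.of_forall fun ω => Finset.sum_nonneg fun j _ => by positivity) hsum A
  rw [integral_finsetSum _ fun j _ => (hint j).mul_const _] at h
  rw [le_div_iff₀ hA, mul_comm]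
  refine h.trans ?_
  calc ∑ j ∈ Finset.range (K + 1), ∫ ω, |ξ j ω| * R ^ j ∂μ
      ≤ ∑ j ∈ Finset.range (K + 1), R ^ j := by
        refine Finset.sum_le_sum fun j _ => ?_
        rw [integral_mul_const]
        exact mul_le_of_le_one_left (by positivity) (hE j)
    _ ≤ ∑' j, R ^ j := (summable_geometric_of_lt_one hR0 hR1).sum_le_tsum _
        fun i _ => by positivity
    _ = 1 / (1 - R) := by rw [tsum_geometric_of_lt_one hR0 hR1, one_div]

/-! ### Assembling the regions -/

lemma maxDeviation_lt_of_forall {Ω : Type*} {ξ : ℕ → Ω → ℝ} {c s : ℝ} (hs : 0 < s) {n : ℕ} {ω : Ω}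
    (h : ∀ k, n ≤ k → k ≤ ⌊c * (n : ℝ)⌋₊ → kacPoly ξ k ω ≠ 0 ∧ kacPoly ξ n ω ≠ 0 ∧
      |(numRoots (kacPoly ξ k ω) (Set.Icc 0 1) : ℝ) - numRoots (kacPoly ξ n ω) (Set.Icc 0 1)|
        ≤ s / 2) :
    maxDeviation ξ c (Set.Icc 0 1) n ω < ENNReal.ofReal s := by
  have hle : maxDeviation ξ c (Set.Icc 0 1) n ω ≤ ENNReal.ofReal (s / 2) := by
    refine iSup₂_le fun k hk => ?_
    obtain ⟨hk1, hk2⟩ := Finset.mem_Icc.1 hk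
    obtain ⟨h1, h2, h3⟩ := h k hk1 hk2
    rw [rootCount_eq_numRoots h1, rootCount_eq_numRoots h2, absDiff, if_neg (by simp)]
    exact ENNReal.ofReal_le_ofReal (by simpa using h3)
  exact hle.trans_lt ((ENNReal.ofReal_lt_ofReal_iff hs).2 (by linarith))

/-- Splitting `[0, 1]` into an inner part, where the counts are small, a part where they agree, and
an outer part, where they are again small. -/
lemma abs_numRoots_sub_le {p r : ℝ[X]} {b u E : ℝ} (hb : 0 ≤ b) (hbu : b ≤ u) (hu : u ≤ 1)
    (hp1 : (numRoots p (Set.Icc 0 b) : ℝ) ≤ E) (hr1 : (numRoots r (Set.Icc 0 b) : ℝ) ≤ E)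
    (hmid : numRoots p (Set.Ioc b u) = numRoots r (Set.Ioc b u))
    (hp2 : (numRoots p (Set.Ioc u 1) : ℝ) ≤ E) (hr2 : (numRoots r (Set.Ioc u 1) : ℝ) ≤ E) :
    |(numRoots p (Set.Icc 0 1) : ℝ) - numRoots r (Set.Icc 0 1)| ≤ 2 * E := by
  have hsplit : ∀ f : ℝ[X], numRoots f (Set.Icc 0 1)
      = numRoots f (Set.Icc 0 b) + numRoots f (Set.Ioc b u) + numRoots f (Set.Ioc u 1) := by
    intro f
    rw [← numRoots_union, Set.Icc_union_Ioc_eq_Icc hb hbu, ← numRoots_union,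
      Set.Icc_union_Ioc_eq_Icc (hb.trans hbu) hu]
    · exact Set.disjoint_left.2 fun x hx hx' => absurd hx.2 (not_le.2 hx'.1)
    · exact Set.disjoint_left.2 fun x hx hx' => absurd hx.2 (not_le.2 hx'.1)
  rw [hsplit p, hsplit r, hmid]
  push_cast
  have h1 : (0:ℝ) ≤ numRoots p (Set.Icc 0 b) := Nat.cast_nonneg _
  have h2 : (0:ℝ) ≤ numRoots r (Set.Icc 0 b) := Nat.cast_nonneg _
  have h3 : (0:ℝ) ≤ numRoots p (Set.Ioc u 1) := Nat.cast_nonneg _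
  have h4 : (0:ℝ) ≤ numRoots r (Set.Ioc u 1) := Nat.cast_nonneg _
  rw [abs_le]
  constructor <;> linarith

set_option maxHeartbeats 1000000 in
/-- The estimate for one large `n`, with `l = log n`: the windows run from distance `h₀` of `1`, a
constant, down to distance about `a l / n`. -/
lemma measureReal_deviation_le {Ω : Type*} [MeasurableSpace Ω] {μ : Measure Ω}
    [IsProbabilityMeasure μ] {ξ : ℕ → Ω → ℝ} {ε₀ M : ℝ} (hε₀ : 0 < ε₀) (hξ : Admissible μ ξ ε₀ M)
    {C h₀ c ε a β lam l : ℝ} {n : ℕ} (hC : 0 < C) (hh₀ : 0 < h₀) (hh₁ : h₀ ≤ 1)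
    (hsb : ∀ u : ℝ, Real.exp (-h₀) ≤ u → u < 1 → ∀ m : ℝ, 0 ≤ m → m ≤ n →
      μ.real {ω | |(kacPoly ξ n ω).eval u| ≤ (√(1 - u))⁻¹ * u ^ m} ≤ C * u ^ (3 / 5 * m))
    (hc : 1 < c) (ha : 0 < a) (hac : 66 * (c * a) ≤ ε) (hlam : 0 < lam)
    (hq : Real.exp (-h₀) / ((1 + Real.exp (-h₀)) / 2) ≤ Real.exp (-lam))
    (hβε : 12 * β ≤ ε * lam) (hn : 1 ≤ n) (hl : l = Real.log n) (hal : 1250 ≤ a * l)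
    (hβl : 1 ≤ β * l) (hl1 : 1 ≤ l) (hln : (3 + a + β) * l ≤ h₀ * n) :
    μ.real {ω | ENNReal.ofReal (ε * l) ≤ maxDeviation ξ c (Set.Icc 0 1) n ω} ≤
      √(2 * c) * Real.exp (-(a * l / 100))
      + 1 / (1 - (1 + Real.exp (-h₀)) / 2) * Real.exp (-(β * l))
      + C * Real.exp (-(3 / 5 * (β * l))) + C * Real.exp (-(3 / 10 * (a * l)))
      + 11 * l * (3 * C * Real.exp (-(a * l / 100))) := by
  have hn0 : (0:ℝ) < n := by exact_mod_cast hn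
  have hl0 : 0 < l := by linarith
  have hal0 : 0 < a * l := by positivity
  have hexpl : Real.exp l = n := by rw [hl, Real.exp_log hn0]
  have hεpos : 0 < ε := lt_of_lt_of_le (by positivity) hac
  set K := ⌊c * (n : ℝ)⌋₊ with hK
  have hKc : (K : ℝ) ≤ c * n := Nat.floor_le (by positivity)
  have hnK : n ≤ K := Nat.le_floor (by nlinarith)
  set D := Real.exp (a * l / 100) with hD
  have hD0 : 0 < D := Real.exp_pos _
  set B := D * √n with hB
  have hsqn : 0 < √(n : ℝ) := Real.sqrt_pos.2 hn0
  have hB0 : 0 < B := by positivity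
  -- the window `I` is the first one at distance at most `11 a l / (10 n)`
  obtain ⟨I, hI1, hI2⟩ := exists_nat_pow_near (x := h₀ * n / (a * l)) (y := 11 / 10)
    (by rw [le_div_iff₀ hal0]; nlinarith) (by norm_num)
  set η : ℕ → ℝ := fun i => h₀ / (11 / 10) ^ i with hη
  have hη0 : ∀ i, 0 < η i := fun i => by simp only [hη]; positivity
  have hηsucc : ∀ i, 11 / 10 * η (i + 1) = η i := fun i => by
    simp only [hη, pow_succ]; field_simp
  have hηle : ∀ i, η i ≤ h₀ := fun i => by
    simp only [hη]
    exact div_le_self hh₀.le (one_le_pow₀ (by norm_num))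
  have hηanti : ∀ i, i ≤ I → a * l ≤ n * η i := fun i hi => by
    have h1 : (11 / 10 : ℝ) ^ i ≤ (11 / 10) ^ I := pow_le_pow_right₀ (by norm_num) hi
    have h2 := h1.trans hI1
    rw [le_div_iff₀ hal0] at h2
    simp only [hη]
    rw [mul_div_assoc', le_div_iff₀ (by positivity)]
    linarith
  have hηI : n * η I ≤ 11 / 10 * (a * l) := by
    rw [div_lt_iff₀ hal0, pow_succ] at hI2
    simp only [hη]
    rw [mul_div_assoc', div_le_iff₀ (by positivity)]
    linarith
  have hIl : (I : ℝ) ≤ 11 * l := by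
    have h1 : (11 / 10 : ℝ) ^ I ≤ Real.exp l := by
      refine hI1.trans ?_
      rw [hexpl, div_le_iff₀ hal0]
      nlinarith
    have h2 : Real.exp (1 / 11) ≤ 11 / 10 := by
      rw [← Real.le_log_iff_exp_le (by norm_num)]
      have := Real.one_sub_inv_le_log_of_pos (show (0:ℝ) < 11 / 10 by norm_num)
      norm_num at this ⊢; linarith
    have h3 : Real.exp (I * (1 / 11)) ≤ Real.exp l := by
      rw [Real.exp_nat_mul]
      exact (pow_le_pow_left₀ (Real.exp_pos _).le h2 I).trans h1
    have := Real.exp_le_exp.1 h3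
    linarith
  set t : ℕ → ℝ := fun i => Real.exp (-η i) with ht
  have htmono : Monotone t := monotone_nat_of_le_succ fun i => by
    simp only [ht]
    apply Real.exp_le_exp.2
    have := hηsucc i; have := hη0 (i + 1); linarith
  have ht0 : t 0 = Real.exp (-h₀) := by simp [ht, hη]
  have hsb' : ∀ u : ℝ, 1 - (1 - Real.exp (-h₀)) ≤ u → u < 1 →
      μ.real {ω | |(coeffPoly (fun j => ξ j ω) n).eval u| ≤ level n u}
        ≤ C * u ^ (3 / 10 * (n : ℝ)) := by
    intro u hu hu1
    refine (hsb u (by linarith) hu1 (n / 2) (by positivity) (by linarith)).trans (le_of_eq ?_)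
    congr 2; ring
  have htκ : ∀ i, 1 - (1 - Real.exp (-h₀)) ≤ Real.exp (-η i) := fun i => by
    have : Real.exp (-h₀) ≤ Real.exp (-η i) := Real.exp_le_exp.2 (by have := hηle i; linarith)
    linarith
  have hDy : ∀ i ≤ I, D ≤ Real.exp (n * η i / 100) := fun i hi => by
    rw [hD]; apply Real.exp_le_exp.2; have := hηanti i hi; linarith
  -- the exceptional events
  set E₁ : Set Ω := {ω | ∃ m ≤ K, B ≤ |∑ j ∈ Finset.range (m + 1), ξ j ω|} with hE₁
  set E₂ : Set Ω := {ω | Real.exp (β * l)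
    ≤ ∑ j ∈ Finset.range (K + 1), |ξ j ω| * ((1 + Real.exp (-h₀)) / 2) ^ j} with hE₂
  set E₃ : Set Ω := {ω | (∀ m ≤ K, |∑ j ∈ Finset.range (m + 1), ξ j ω| ≤ B) ∧
      ∑ j ∈ Finset.range (K + 1), |ξ j ω| * ((1 + Real.exp (-h₀)) / 2) ^ j ≤ Real.exp (β * l) ∧
      ∃ k, n ≤ k ∧ k ≤ K ∧
      ¬ (numRoots (coeffPoly (fun j => ξ j ω) k) (Set.Icc 0 (Real.exp (-h₀))) : ℝ) * lam
        ≤ 3 * (β * l)} with hE₃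
  set E₄ : Set Ω := {ω | (∀ m ≤ K, |∑ j ∈ Finset.range (m + 1), ξ j ω| ≤ B) ∧
      ∃ k, n ≤ k ∧ k ≤ K ∧ ¬ (coeffPoly (fun j => ξ j ω) k ≠ 0 ∧
        (numRoots (coeffPoly (fun j => ξ j ω) k) (Set.Ioc (Real.exp (-η I)) 1) : ℝ)
          ≤ 15 * c * (n * η I))} with hE₄
  set W : ℕ → Set Ω := fun i => {ω | (∀ m ≤ K, |∑ j ∈ Finset.range (m + 1), ξ j ω| ≤ B) ∧
      ∃ k, n ≤ k ∧ k ≤ K ∧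
      numRoots (coeffPoly (fun j => ξ j ω) k)
        (Set.Ioc (Real.exp (-(11 / 10 * η (i + 1)))) (Real.exp (-η (i + 1))))
      ≠ numRoots (coeffPoly (fun j => ξ j ω) n)
        (Set.Ioc (Real.exp (-(11 / 10 * η (i + 1)))) (Real.exp (-η (i + 1))))} with hW
  have hsub : {ω | ENNReal.ofReal (ε * l) ≤ maxDeviation ξ c (Set.Icc 0 1) n ω} ⊆
      E₁ ∪ E₂ ∪ E₃ ∪ E₄ ∪ ⋃ i ∈ Finset.range I, W i := by
    intro ω hω
    by_contra hcon
    simp only [Set.mem_union, not_or] at hcon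
    obtain ⟨⟨⟨⟨h1, h2⟩, h3⟩, h4⟩, h5⟩ := hcon
    have g1 : ∀ m ≤ K, |∑ j ∈ Finset.range (m + 1), ξ j ω| ≤ B := by
      intro m hm
      by_contra hc'
      push Not at hc'
      exact h1 ⟨m, hm, hc'.le⟩
    have g2 : ∑ j ∈ Finset.range (K + 1), |ξ j ω| * ((1 + Real.exp (-h₀)) / 2) ^ j
        ≤ Real.exp (β * l) := by
      by_contra hc'
      push Not at hc'
      exact h2 hc'.le
    have g3 : ∀ k, n ≤ k → k ≤ K →
        (numRoots (coeffPoly (fun j => ξ j ω) k) (Set.Icc 0 (t 0)) : ℝ) ≤ ε * l / 4 := by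
      intro k hnk hk
      have h6 : (numRoots (coeffPoly (fun j => ξ j ω) k) (Set.Icc 0 (t 0)) : ℝ) * lam
          ≤ 3 * (β * l) := by
        by_contra hc'
        rw [ht0] at hc'
        exact h3 ⟨g1, g2, k, hnk, hk, hc'⟩
      refine le_of_mul_le_mul_right (h6.trans ?_) hlam
      nlinarith
    have g4 : ∀ k, n ≤ k → k ≤ K → coeffPoly (fun j => ξ j ω) k ≠ 0 ∧
        (numRoots (coeffPoly (fun j => ξ j ω) k) (Set.Ioc (t I) 1) : ℝ) ≤ ε * l / 4 := by
      intro k hnk hk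
      have h6 : coeffPoly (fun j => ξ j ω) k ≠ 0 ∧
          (numRoots (coeffPoly (fun j => ξ j ω) k) (Set.Ioc (t I) 1) : ℝ)
            ≤ 15 * c * (n * η I) := by
        by_contra hc'
        exact h4 ⟨g1, k, hnk, hk, hc'⟩
      refine ⟨h6.1, h6.2.trans ?_⟩
      calc 15 * c * (n * η I) ≤ 15 * c * (11 / 10 * (a * l)) := by gcongr
        _ = (66 * (c * a)) * l / 4 := by ring
        _ ≤ ε * l / 4 := by gcongr
    have g5 : ∀ k, n ≤ k → k ≤ K →
        numRoots (coeffPoly (fun j => ξ j ω) k) (Set.Ioc (t 0) (t I))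
          = numRoots (coeffPoly (fun j => ξ j ω) n) (Set.Ioc (t 0) (t I)) := by
      intro k hnk hk
      refine numRoots_Ioc_eq_of_forall_cell htmono I fun i hi => ?_
      by_contra hc'
      apply h5
      simp only [Set.mem_iUnion, Finset.mem_range]
      refine ⟨i, hi, g1, k, hnk, hk, ?_⟩
      rw [hηsucc]
      exact hc'
    refine absurd hω (not_le.2 (maxDeviation_lt_of_forall (by positivity) fun k hnk hk => ?_))
    refine ⟨(g4 k hnk hk).1, (g4 n le_rfl hnK).1, ?_⟩
    have := abs_numRoots_sub_le (Real.exp_pos _).le (htmono (Nat.zero_le I))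
      (Real.exp_le_one_iff.2 (by have := hη0 I; linarith)) (g3 k hnk hk) (g3 n le_rfl hnK)
      (g5 k hnk hk) (g4 k hnk hk).2 (g4 n le_rfl hnK).2
    refine this.trans (le_of_eq ?_)
    ring
  -- their probabilities
  have p1 : μ.real E₁ ≤ √(2 * c) * Real.exp (-(a * l / 100)) := by
    refine (measureReal_exists_le_abs_sum_le hξ.measurable hξ.indep (hξ.memLp_two hε₀) hξ.mean
      hξ.variance K hB0).trans ?_
    rw [div_le_iff₀ hB0, hB]
    have e : √(2 * c) * Real.exp (-(a * l / 100)) * (D * √n) = √(2 * c * n) := by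
      rw [Real.sqrt_mul (by positivity) (n : ℝ), hD, Real.exp_neg]
      field_simp
    rw [e]
    apply Real.sqrt_le_sqrt
    have : (1:ℝ) ≤ n := by exact_mod_cast hn
    nlinarith
  have hb1 : Real.exp (-h₀) < 1 := by rw [Real.exp_lt_one_iff]; linarith
  have p2 : μ.real E₂ ≤ 1 / (1 - (1 + Real.exp (-h₀)) / 2) * Real.exp (-(β * l)) := by
    refine (measureReal_sum_abs_mul_pow_le (hξ.memLp_two hε₀) (hξ.integral_sq hε₀)
      (by positivity) (by linarith) K (Real.exp_pos _)).trans (le_of_eq ?_)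
    rw [Real.exp_neg (β * l), div_eq_mul_inv]
  have p3 : μ.real E₃ ≤ C * Real.exp (-(3 / 5 * (β * l))) := by
    refine measureReal_inner_le hh₀ (fun m hm0 hmn => hsb _ le_rfl hb1 m hm0 hmn) hq hβl
      (by nlinarith) ?_
    -- crudely, `4 B ≤ exp ((3 + a) l)`
    have h4 : (4:ℝ) ≤ Real.exp (2 * l) := by
      have := Real.quadratic_le_exp_of_nonneg (x := 2 * l) (by positivity); nlinarith
    have hsq : √(n : ℝ) ≤ Real.exp l := by
      rw [hexpl, Real.sqrt_le_left hn0.le]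
      have : (1:ℝ) ≤ n := by exact_mod_cast hn
      nlinarith
    calc 4 * B * Real.exp (-(h₀ * n))
        ≤ Real.exp (2 * l) * (Real.exp (a * l / 100) * Real.exp l) * Real.exp (-(h₀ * n)) := by
          rw [hB, hD]; gcongr
      _ = Real.exp (2 * l + a * l / 100 + l - h₀ * n) := by
          rw [← Real.exp_add, ← Real.exp_add, ← Real.exp_add]; congr 1; ring
      _ ≤ Real.exp (-(β * l)) := by
          apply Real.exp_le_exp.2; nlinarith
  have p4 : μ.real E₄ ≤ C * Real.exp (-(3 / 10 * (a * l))) := by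
    refine (measureReal_near_one_le hc hsb' hD0 hB hn hKc (hη0 I) (htκ I)
      (hal.trans (hηanti I le_rfl)) (hDy I le_rfl)).trans ?_
    refine mul_le_mul_of_nonneg_left (Real.exp_le_exp.2 ?_) hC.le
    have := hηanti I le_rfl
    linarith
  have p5 : ∀ i ∈ Finset.range I, μ.real (W i) ≤ 3 * C * Real.exp (-(a * l / 100)) := by
    intro i hi
    have hi' : i + 1 ≤ I := Finset.mem_range.1 hi
    refine (measureReal_window_le hC hsb' hD0 hB hn (hη0 (i + 1))
      (by rw [hηsucc]; exact htκ i) (hal.trans (hηanti _ hi')) (hDy _ hi')).trans ?_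
    refine mul_le_mul_of_nonneg_left (Real.exp_le_exp.2 ?_) (by positivity)
    have := hηanti _ hi'
    linarith
  have p5' : μ.real (⋃ i ∈ Finset.range I, W i) ≤ 11 * l * (3 * C * Real.exp (-(a * l / 100))) := by
    refine (measureReal_biUnion_finset_le _ _).trans ((Finset.sum_le_sum p5).trans ?_)
    rw [Finset.sum_const, Finset.card_range, nsmul_eq_mul]
    gcongr
  refine (measureReal_mono hsub (measure_ne_top _ _)).trans ?_
  have u1 := measureReal_union_le (μ := μ) (E₁ ∪ E₂ ∪ E₃ ∪ E₄) (⋃ i ∈ Finset.range I, W i)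
  have u2 := measureReal_union_le (μ := μ) (E₁ ∪ E₂ ∪ E₃) E₄
  have u3 := measureReal_union_le (μ := μ) (E₁ ∪ E₂) E₃
  have u4 := measureReal_union_le (μ := μ) E₁ E₂
  linarith

end KacRoots

theorem lemma2p4 (ε₀ M ε c : ℝ) (hε₀ : 0 < ε₀) (hε : 0 < ε) (hc : 1 < c) :
    ∃ c₁ : ℝ, 0 < c₁ ∧ ∃ K : ℝ, 0 < K ∧
      ∀ (Ω : Type*) [MeasurableSpace Ω] (μ : Measure Ω) [IsProbabilityMeasure μ]
        (ξ : ℕ → Ω → ℝ), KacRoots.Admissible μ ξ ε₀ M →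
        ∀ n : ℕ, 1 ≤ n →
          μ.real {ω | ENNReal.ofReal (ε * Real.log n) ≤
              KacRoots.maxDeviation ξ c (Set.Icc 0 1) n ω} ≤ K * (n : ℝ) ^ (-c₁) := by
  obtain ⟨C, κ, hC, hκ0, hκ1, hsb⟩ := KacRoots.exists_measureReal_abs_eval_le ε₀ M hε₀
  have hb1 : Real.exp (-κ) < 1 := by rw [Real.exp_lt_one_iff]; linarith
  have hb0 : 0 < Real.exp (-κ) := Real.exp_pos _
  set a := ε / (66 * c) with ha
  have ha0 : 0 < a := by positivity
  have hac : 66 * (c * a) ≤ ε := by rw [ha]; apply le_of_eq; field_simp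
  -- `exp (-lam)` is the Blaschke ratio of the inner disc
  set q := Real.exp (-κ) / ((1 + Real.exp (-κ)) / 2) with hq
  have hq0 : 0 < q := by positivity
  have hq1 : q < 1 := by rw [hq, div_lt_one (by positivity)]; linarith
  set lam := -Real.log q with hlam
  have hlam0 : 0 < lam := by rw [hlam]; have := Real.log_neg hq0 hq1; linarith
  have hqlam : q ≤ Real.exp (-lam) := by rw [hlam, neg_neg, Real.exp_log hq0]
  set β := ε * lam / 12 with hβ
  have hβ0 : 0 < β := by positivity
  obtain ⟨n₀, hn₀1, hn₀⟩ : ∃ n₀ : ℕ, 1 ≤ n₀ ∧ ∀ n ≥ n₀, 1250 ≤ a * Real.log n ∧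
      1 ≤ β * Real.log n ∧ 1 ≤ Real.log n ∧ (3 + a + β) * Real.log n ≤ κ * n := by
    have hlog : Filter.Tendsto (fun n : ℕ => Real.log n) Filter.atTop Filter.atTop :=
      Real.tendsto_log_atTop.comp tendsto_natCast_atTop_atTop
    have e1 := (hlog.const_mul_atTop ha0).eventually_ge_atTop 1250
    have e2 := (hlog.const_mul_atTop hβ0).eventually_ge_atTop 1
    have e3 := hlog.eventually_ge_atTop 1
    have e4 : ∀ᶠ n : ℕ in Filter.atTop, (3 + a + β) * Real.log n ≤ κ * n := by
      have h := (Real.isLittleO_log_id_atTop.comp_tendsto tendsto_natCast_atTop_atTop).bound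
        (show 0 < κ / (3 + a + β) by positivity)
      filter_upwards [h, e3] with n hn h3
      simp only [Function.comp, id, Real.norm_eq_abs, Nat.abs_cast] at hn
      rw [abs_of_pos (by linarith), div_mul_eq_mul_div, le_div_iff₀ (by positivity)] at hn
      linarith
    obtain ⟨N, hN⟩ := Filter.eventually_atTop.1 ((e1.and e2).and (e3.and e4))
    refine ⟨max N 1, le_max_right _ _, fun n hn => ?_⟩
    obtain ⟨⟨x1, x2⟩, x3, x4⟩ := hN n ((le_max_left _ _).trans hn)
    exact ⟨x1, x2, x3, x4⟩
  set c₁ := min (a / 200) (3 / 5 * β) with hc₁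
  have hc₁0 : 0 < c₁ := by positivity
  have hc₁a : c₁ ≤ a / 200 := min_le_left _ _
  have hc₁β : c₁ ≤ 3 / 5 * β := min_le_right _ _
  set K₁ := √(2 * c) + 1 / (1 - (1 + Real.exp (-κ)) / 2) + C + C + 6600 * C / a with hK₁
  have hR : 0 < 1 / (1 - (1 + Real.exp (-κ)) / 2) := by
    apply one_div_pos.2; linarith
  have hK₁0 : 0 < K₁ := by positivity
  have hn₀0 : (0:ℝ) < n₀ := by exact_mod_cast hn₀1
  refine ⟨c₁, hc₁0, K₁ + (n₀ : ℝ) ^ c₁, by positivity, ?_⟩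
  intro Ω _ μ _ ξ hξ n hn
  have hn0 : (0:ℝ) < n := by exact_mod_cast hn
  rcases lt_or_ge n n₀ with hlt | hge
  · -- small `n`: the bound exceeds `1`
    refine measureReal_le_one.trans ?_
    have h1 : (n : ℝ) ^ c₁ ≤ (n₀ : ℝ) ^ c₁ := by gcongr
    calc (1:ℝ) = (n : ℝ) ^ c₁ * (n : ℝ) ^ (-c₁) := by rw [← Real.rpow_add hn0]; simp
      _ ≤ (K₁ + (n₀ : ℝ) ^ c₁) * (n : ℝ) ^ (-c₁) := by gcongr; linarith
  · obtain ⟨x1, x2, x3, x4⟩ := hn₀ n hge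
    set l := Real.log n with hl
    have hmain := KacRoots.measureReal_deviation_le hε₀ hξ (C := C) (h₀ := κ) (c := c) (ε := ε)
      (a := a) (β := β) (lam := lam) (l := l) (n := n) hC hκ0 (by linarith)
      (fun u hu hu1 m hm0 hmn => hsb Ω μ ξ hξ u
        (by have := Real.one_sub_le_exp_neg κ; linarith) hu1 n m hm0 hmn)
      hc ha0 hac hlam0 hqlam (by rw [hβ]; linarith) hn hl x1 x2 x3 x4
    refine hmain.trans ?_
    have hpow : (n : ℝ) ^ (-c₁) = Real.exp (-(c₁ * l)) := by
      rw [Real.rpow_def_of_pos hn0, ← hl]; congr 1; ring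
    rw [hpow]
    set P := Real.exp (-(c₁ * l)) with hP
    have hP0 : 0 < P := Real.exp_pos _
    have hl0 : 0 < l := by linarith
    have hle : ∀ s : ℝ, c₁ * l ≤ s → Real.exp (-s) ≤ P := fun s hs => by
      rw [hP]; apply Real.exp_le_exp.2; linarith
    have hal : c₁ * l ≤ a / 200 * l := by gcongr
    have hβl : c₁ * l ≤ 3 / 5 * β * l := by gcongr
    have hal0 : 0 < a * l := by positivity
    have hβl0 : 0 < β * l := by positivity
    have t1 := hle (a * l / 100) (by linarith)
    have t2 := hle (β * l) (by linarith)
    have t3 := hle (3 / 5 * (β * l)) (by linarith)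
    have t4 := hle (3 / 10 * (a * l)) (by linarith)
    -- the number of windows costs half of the exponent
    have t5 : l * Real.exp (-(a * l / 100)) ≤ 200 / a * P := by
      have h1 : l ≤ 200 / a * Real.exp (a * l / 200) := by
        have := Real.add_one_le_exp (a * l / 200)
        rw [div_mul_eq_mul_div, le_div_iff₀ ha0]; linarith
      calc l * Real.exp (-(a * l / 100))
          ≤ 200 / a * Real.exp (a * l / 200) * Real.exp (-(a * l / 100)) := by gcongr
        _ = 200 / a * Real.exp (-(a * l / 200)) := by
          rw [mul_assoc, ← Real.exp_add]; congr 2; ring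
        _ ≤ 200 / a * P := by
          gcongr
          exact hle _ (by linarith)
    have t6 : 11 * l * (3 * C * Real.exp (-(a * l / 100))) ≤ 6600 * C / a * P := by
      calc 11 * l * (3 * C * Real.exp (-(a * l / 100)))
          = 33 * C * (l * Real.exp (-(a * l / 100))) := by ring
        _ ≤ 33 * C * (200 / a * P) := by gcongr
        _ = 6600 * C / a * P := by ring
    have hsum : √(2 * c) * Real.exp (-(a * l / 100))
        + 1 / (1 - (1 + Real.exp (-κ)) / 2) * Real.exp (-(β * l))
        + C * Real.exp (-(3 / 5 * (β * l))) + C * Real.exp (-(3 / 10 * (a * l)))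
        + 11 * l * (3 * C * Real.exp (-(a * l / 100))) ≤ K₁ * P := by
      rw [hK₁, add_mul, add_mul, add_mul, add_mul]
      gcongr
    refine hsum.trans ?_
    have : 0 < (n₀ : ℝ) ^ c₁ := by positivity
    gcongr
    linarith
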